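/- A tree is a partially ordered set $\langle T,\le_T\rangle$ with a minimal element such that $\{s\in T : s\le_T t\}$ is well ordered by $\le_T$ for every $t\in T$; the level $\mathrm{Lev}_T(t)$ of $t$ is the order type of $\{s\in T: s<_T t\}$. For a cardinal $\kappa$, $T$ is a $\kappa$-tree if $\sup_{t\in T}(\mathrm{Lev}_T(t)+1)=\kappa$ and every level of $T$ has cardinality $<\kappa$. The tree property holds at $\kappa$ if every $\kappa$-tree has a cofinal branch, i.e. a chain meeting cofinally many levels. For a cardinal $\mu$, $\mathrm{Col}(\omega,\mu)$ is the forcing notion of finite partial functions from $\omega$ to $\mu$, ordered by reverse inclusion. Let $\lambda$ be an infinite cardinal. (1) Suppose that the tree property holds at $\lambda^+$ and that for every cardinal $\mu<\lambda$ the forcing $\mathrm{Col}(\omega,\mu)$ forces the tree property at $\lambda^+$. Then every forcing notion $\mathbb{P}$ with $|\mathbb{P}|<\lambda$ forces the tree property at $\lambda^+$. (2) Moreover, it is enough to assume that for every cardinal $\mu<\lambda$ there is a cardinal $\mu'$ with $\mu\le\mu'<\lambda$ such that $\mathrm{Col}(\omega,\mu')$ forces the tree property at $\lambda^+$: under this assumption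 the tree property holds at $\lambda^+$, and every forcing notion $\mathbb{P}$ with $|\mathbb{P}|<\lambda$ forces the tree property at $\lambda^+$. -/

import Mathlib

universe u

section SetTheory

open FirstOrder FirstOrder.Language

/-! ## The language of set theory and its standard interpretation -/

/-- The relation symbols of the language of set theory: a single binary symbol. -/
inductive MemSymb : ℕ → Type
  | mem : MemSymb 2

/-- The first-order language of set theory, `{∈}`. -/
def setLang : Language := ⟨fun _ => Empty, MemSymb⟩

/-- Formulas of set theory whose free variables are indexed by `Fin n`. -/
abbrev Fml (n : ℕ) := setLang.BoundedFormula Empty n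

/-- The ground model `V`: Mathlib's universe of ZFC sets with its membership relation. -/
instance ZFSet.instSetLangStructure : setLang.Structure ZFSet.{u} where
  funMap := fun f _ => nomatch f
  RelMap := fun {_} r xs =>
    match r, xs with
    | MemSymb.mem, xs => xs 0 ∈ xs 1

/-! ## Forcing -/

/-- `P`-names: a `P`-name is a (small) set of pairs `(σ, p)` with `σ` a `P`-name and `p ∈ P`. -/
inductive PName (P : Type u) : Type (u + 1)
  | mk (ι : Type u) (name : ι → PName P) (cond : ι → P) : PName P

namespace PName

variable {P : Type u}

/-- The canonical name `x̌ = {(y̌, p) : y ∈ x, p ∈ P}` of a set `x` of the ground model. -/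
def check (P : Type u) : PSet.{u} → PName P
  | ⟨ι, A⟩ => ⟨ι × P, fun i => check P (A i.1), fun i => i.2⟩

variable [Preorder P]

/-- `p ⊩ a = b` (smaller conditions are stronger): whenever `(σ, r)` is in one of the names, the
conditions which, for some pair `(τ, s)` in the other name, are below `s` and force `σ = τ`,
are dense below every common extension of `p` and `r`. -/
def ForcesEq : PName P → PName P → P → Prop
  | ⟨_, x, r⟩, ⟨_, y, s⟩, p =>
    (∀ i, ∀ q ≤ p, q ≤ r i → ∃ q' ≤ q, ∃ j, q' ≤ s j ∧ ForcesEq (x i) (y j) q') ∧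
    (∀ j, ∀ q ≤ p, q ≤ s j → ∃ q' ≤ q, ∃ i, q' ≤ r i ∧ ForcesEq (x i) (y j) q')

/-- `p ⊩ a ∈ b`: the conditions which, for some pair `(τ, s)` in `b`, are below `s` and force
`a = τ`, are dense below `p`. -/
def ForcesMem (a : PName P) : PName P → P → Prop
  | ⟨_, y, s⟩, p => ∀ q ≤ p, ∃ q' ≤ q, ∃ j, q' ≤ s j ∧ ForcesEq a (y j) q'

/-- The value of a term; the language has no function symbols, so a term is a variable. -/
def ofTerm {n : ℕ} (v : Fin n → PName P) : setLang.Term (Empty ⊕ Fin n) → PName P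
  | .var (.inr i) => v i
  | .var (.inl e) => nomatch e
  | .func f _ => nomatch f

/-- The forcing relation `p ⊩ φ(v)` for arbitrary formulas of set theory. In Mathlib formulas are
built from atoms, falsum, implication and `∀`; negation, conjunction, disjunction and `∃` are the
classical abbreviations. -/
def Forces : {n : ℕ} → Fml n → (Fin n → PName P) → P → Prop
  | _, .falsum, _, _ => False
  | _, .equal a b, v, p => ForcesEq (ofTerm v a) (ofTerm v b) p
  | _, .rel MemSymb.mem ts, v, p => ForcesMem (ofTerm v (ts 0)) (ofTerm v (ts 1)) p
  | _, .imp φ ψ, v, p => ∀ q ≤ p, Forces φ v q → Forces ψ v q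
  | _, .all φ, v, p => ∀ x : PName P, Forces φ (Fin.snoc v x) p

end PName

/-! ## The tree property as a formula of set theory

The arguments of the formulas below are variables, i.e. elements of `Fin n`. Under a quantifier the
new variable is `Fin.last n`, and an old variable `x` is written `x↟`. -/

local postfix:max "↟" => Fin.castSucc

namespace Fml

variable {n : ℕ}

/-- `x ∈ y`. -/
def mem (x y : Fin n) : Fml n :=
  .rel MemSymb.mem ![.var (.inr x), .var (.inr y)]

/-- `x = y`. -/
def eq (x y : Fin n) : Fml n :=
  .equal (.var (.inr x)) (.var (.inr y))

/-- `∀ x, φ(x)`. -/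
def all (φ : Fin (n + 1) → Fml (n + 1)) : Fml n := ∀' (φ (Fin.last n))

/-- `∃ x, φ(x)`. -/
def ex (φ : Fin (n + 1) → Fml (n + 1)) : Fml n := ∃' (φ (Fin.last n))

/-- `∀ x ∈ a, φ(x)`. -/
def ball (a : Fin n) (φ : Fin (n + 1) → Fml (n + 1)) : Fml n :=
  all fun x => mem x a↟ ⟹ φ x

/-- `∃ x ∈ a, φ(x)`. -/
def bex (a : Fin n) (φ : Fin (n + 1) → Fml (n + 1)) : Fml n :=
  ex fun x => mem x a↟ ⊓ φ x

/-- `w = {x, y}`. -/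
def isUPair (w x y : Fin n) : Fml n :=
  mem x w ⊓ mem y w ⊓ ball w fun u => eq u x↟ ⊔ eq u y↟

/-- `z = (x, y) = {{x}, {x, y}}`. -/
def isPair (z x y : Fin n) : Fml n :=
  (bex z fun w => isUPair w x↟ x↟) ⊓ (bex z fun w => isUPair w x↟ y↟) ⊓
    ball z fun w => isUPair w x↟ x↟ ⊔ isUPair w x↟ y↟

/-- `(x, y) ∈ r`. -/
def pairMem (r x y : Fin n) : Fml n :=
  bex r fun z => isPair z x↟ y↟

/-- `f` is a function from `A` to `B`. -/
def isFunc (f A B : Fin n) : Fml n :=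
  (ball f fun z => bex A↟ fun x => bex B↟↟ fun y => isPair z↟↟ x↟ y) ⊓
  (ball A fun x => bex B↟ fun y => pairMem f↟↟ x↟ y) ⊓
  (ball A fun x => ball B↟ fun y => ball B↟↟ fun y' =>
    pairMem f↟↟↟ x↟↟ y↟ ⟹ pairMem f↟↟↟ x↟↟ y' ⟹ eq y↟ y')

/-- The function `f` from `A` to `B` is injective. -/
def isInj (f A B : Fin n) : Fml n :=
  ball A fun x => ball A↟ fun x' => ball B↟↟ fun y =>
    pairMem f↟↟↟ x↟↟ y ⟹ pairMem f↟↟↟ x'↟ y ⟹ eq x↟↟ x'↟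

/-- The function `f` from `A` to `B` is surjective. -/
def isSurj (f A B : Fin n) : Fml n :=
  ball B fun y => bex A↟ fun x => pairMem f↟↟ x y↟

/-- `R` (a set of ordered pairs, `(x, y) ∈ R` meaning `x ≤ y`) is a partial order on `T`. -/
def isPartialOrder (T R : Fin n) : Fml n :=
  (ball T fun x => pairMem R↟ x x) ⊓
  (ball T fun x => ball T↟ fun y => pairMem R↟↟ x↟ y ⟹ pairMem R↟↟ y x↟ ⟹ eq x↟ y) ⊓
  (ball T fun x => ball T↟ fun y => ball T↟↟ fun z =>
    pairMem R↟↟↟ x↟↟ y↟ ⟹ pairMem R↟↟↟ y↟ z ⟹ pairMem R↟↟↟ x↟↟ z)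

/-- For every `t ∈ T`, the set `{s ∈ T | s ≤ t}` is well ordered by `R`: each of its nonempty
subsets `X` has a least element. -/
def predsWellOrdered (T R : Fin n) : Fml n :=
  ball T fun t => all fun X =>
    (ball X fun s => mem s T↟↟↟ ⊓ pairMem R↟↟↟ s t↟↟) ⟹
    (bex X fun s => eq s s) ⟹
    bex X fun m => ball X↟ fun s => pairMem R↟↟↟↟ m↟ s

/-- `(T, R)` is a tree: a partial order with a minimal element in which the set of elements below
any given element is well ordered. -/
def isTree (T R : Fin n) : Fml n :=
  isPartialOrder T R ⊓
  (bex T fun m => ball T↟ fun s => pairMem R↟↟ s m↟ ⟹ eq s m↟) ⊓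
  predsWellOrdered T R

/-- `A = {s ∈ T | s < t}`. -/
def isPredSet (A T R t : Fin n) : Fml n :=
  (ball A fun s => mem s T↟ ⊓ (pairMem R↟ s t↟ ⊓ ∼(eq s t↟))) ⊓
  (ball T fun s => pairMem R↟ s t↟ ⟹ ∼(eq s t↟) ⟹ mem s A↟)

/-- The level of `t` in the tree `(T, R)` is the ordinal `α`: the set `{s ∈ T | s < t}` with the
order `R` is isomorphic to `α`. (It is used for elements `α` of an ordinal only.) -/
def isLevel (T R t α : Fin n) : Fml n :=
  ex fun A => isPredSet A T↟ R↟ t↟ ⊓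
    ex fun f => isFunc f A↟ α↟↟ ⊓ isInj f A↟ α↟↟ ⊓ isSurj f A↟ α↟↟ ⊓
      ball A↟ fun s => ball A↟↟ fun s' => ball α↟↟↟↟ fun β => ball α↟↟↟↟↟ fun β' =>
        pairMem f↟↟↟↟ s↟↟↟ β↟ ⟹ pairMem f↟↟↟↟ s'↟↟ β' ⟹
          (pairMem R↟↟↟↟↟↟ s↟↟↟ s'↟↟ ⇔ (mem β↟ β' ⊔ eq β↟ β'))

/-- `|L| < κ`, for an ordinal `κ`: there is an injection of `L` into an element of `κ`. -/
def cardLT (L κ : Fin n) : Fml n :=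
  bex κ fun β => ex fun f => isFunc f L↟↟ β↟ ⊓ isInj f L↟↟ β↟

/-- `L` is the set of elements of `T` of level `α`. -/
def isLevelSet (L T R α : Fin n) : Fml n :=
  (ball L fun t => mem t T↟ ⊓ isLevel T↟ R↟ t α↟) ⊓
  (ball T fun t => isLevel T↟ R↟ t α↟ ⟹ mem t L↟)

/-- The levels of the elements of `X` are cofinal in `κ`. -/
def levelsCofinal (X T R κ : Fin n) : Fml n :=
  ball κ fun α => bex X↟ fun t => bex κ↟↟ fun β =>
    isLevel T↟↟↟ R↟↟↟ t↟ β ⊓ (mem α↟↟ β ⊔ eq α↟↟ β)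

/-- `(T, R)` is a `κ`-tree: it is a tree, the supremum of `Lev(t) + 1` over `t ∈ T` is `κ` (all
levels are below `κ`, and they are cofinal in `κ`), and each level has cardinality below `κ`. -/
def isKappaTree (T R κ : Fin n) : Fml n :=
  isTree T R ⊓
  (ball T fun t => bex κ↟ fun α => isLevel T↟↟ R↟↟ t↟ α) ⊓
  levelsCofinal T T R κ ⊓
  (ball κ fun α => ex fun L => isLevelSet L T↟↟ R↟↟ α↟ ⊓ cardLT L κ↟↟)

/-- `b` is a cofinal branch of `(T, R)`: a chain in `T` meeting cofinally many levels. -/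
def isCofinalBranch (b T R κ : Fin n) : Fml n :=
  (ball b fun s => mem s T↟) ⊓
  (ball b fun s => ball b↟ fun t => pairMem R↟↟ s↟ t ⊔ pairMem R↟↟ t s↟) ⊓
  levelsCofinal b T R κ

/-- `κ` has the tree property: every `κ`-tree has a cofinal branch. -/
def treeProperty (κ : Fin n) : Fml n :=
  all fun T => all fun R => isKappaTree T↟ R κ↟↟ ⟹
    ex fun b => isCofinalBranch b T↟↟ R↟ κ↟↟↟

end Fml

/-- The tree property holds at the cardinal `κ` (in `V`). -/
def TreePropertyAt (κ : Cardinal.{u}) : Prop :=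
  (Fml.treeProperty (0 : Fin 1)).Realize (M := ZFSet.{u}) Empty.elim ![κ.ord.toZFSet]

/-- `P` forces the tree property at `κ`: every condition forces the tree property for the canonical
name of `κ`. -/
def ForcesTreePropertyAt (P : Type u) [Preorder P] (κ : Cardinal.{u}) : Prop :=
  ∀ p : P, PName.Forces (Fml.treeProperty (0 : Fin 1)) ![PName.check P κ.ord.toPSet] p

end SetTheory

/-! ## The collapse -/

/-- Conditions of `Col(ω, X)`: finite partial functions from `ω` to `X`. -/
@[ext]
structure Col (X : Type u) : Type u where
  /-- the partial function -/
  toFun : ℕ → Option X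
  /-- its domain is finite -/
  finite_dom : {n | toFun n ≠ none}.Finite

/-- Conditions are ordered by reverse inclusion. -/
instance Col.instPartialOrder (X : Type u) : PartialOrder (Col X) where
  le p q := ∀ n x, q.toFun n = some x → p.toFun n = some x
  le_refl _ _ _ h := h
  le_trans _ _ _ h₁ h₂ n x h := h₁ n x (h₂ n x h)
  le_antisymm _ _ h₁ h₂ := by
    ext n x
    exact ⟨h₂ n x, h₁ n x⟩

/-- `Col(ω, μ)`, for a cardinal `μ`. -/
abbrev ColOmega (μ : Cardinal.{u}) : Type u := Col μ.ord.ToType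

/-! Let `P` have size less than `λ`, and choose `μ < λ` with `|P| ≤ μ` such that `Col(ω, μ)` forces
the tree property at `λ⁺`. Fix a condition `p` of `P`. Once `P` is enumerated by `μ`, a condition of
the collapse reads as a list of instructions for a descending walk in `P` from `p`. This gives a
projection of the collapse to `P` with range below `p` (`Col.isProjection_walk`), so an extension by
the collapse contains an extension by `P`, and `P`-names translate to names for the collapse
(`pull`).

A `λ⁺`-tree of the smaller extension is still one in the larger (`ForcesKappaTree.pull`). Most
clauses are bounded or existential and go up for that reason. Well-orderedness and the exact extent
of the levels are recovered from the isomorphisms with ordinals that define levels, and from their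
uniqueness (`ForcesLevel.unique`). The larger extension therefore has a cofinal branch `b`.

The collapse has at most `λ` conditions, and `λ⁺` is regular. If for each condition the nodes it
decides to lie in `b` were bounded in the tree, the supremum of these bounds would be below `λ⁺`,
although some condition puts a node of higher level into `b`. So a single condition decides
cofinally many nodes, and these form a branch that already has a `P`-name
(`ForcesBranch.exists_decided`). The ground model is treated as the extension by the one-point
forcing. -/

section ForcingBasics

open FirstOrder FirstOrder.Language

/-! ### Basic laws of the forcing relation. -/

namespace PName

variable {P : Type u} [Preorder P]

theorem ForcesEq.mono {a b : PName P} {p q : P} (h : ForcesEq a b p) (hq : q ≤ p) :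
    ForcesEq a b q := by
  cases a; cases b
  exact ⟨fun i r hr => h.1 i r (hr.trans hq), fun i r hr => h.2 i r (hr.trans hq)⟩

theorem ForcesEq.of_dense {a b : PName P} {p : P}
    (h : ∀ q ≤ p, ∃ r ≤ q, ForcesEq a b r) : ForcesEq a b p := by
  cases a; cases b
  constructor
  · intro i q hq hqi
    obtain ⟨r, hr, hab⟩ := h q hq
    obtain ⟨s, hs, w⟩ := hab.1 i r le_rfl (hr.trans hqi)
    exact ⟨s, hs.trans hr, w⟩
  · intro i q hq hqi
    obtain ⟨r, hr, hab⟩ := h q hq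
    obtain ⟨s, hs, w⟩ := hab.2 i r le_rfl (hr.trans hqi)
    exact ⟨s, hs.trans hr, w⟩

theorem ForcesEq.refl (a : PName P) (p : P) : ForcesEq a a p := by
  induction a generalizing p with
  | mk ι x r ih =>
    exact ⟨fun i q _ hi => ⟨q, le_rfl, i, hi, ih i q⟩, fun i q _ hi => ⟨q, le_rfl, i, hi, ih i q⟩⟩

theorem ForcesEq.symm {a b : PName P} {p : P} (h : ForcesEq a b p) : ForcesEq b a p := by
  induction a generalizing b p with
  | mk ι x r ih =>
    cases b
    refine ⟨fun i q hq hi => ?_, fun i q hq hi => ?_⟩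
    · obtain ⟨q', hq', j, hj, e⟩ := h.2 i q hq hi
      exact ⟨q', hq', j, hj, ih _ e⟩
    · obtain ⟨q', hq', j, hj, e⟩ := h.1 i q hq hi
      exact ⟨q', hq', j, hj, ih _ e⟩

theorem ForcesEq.trans {a b c : PName P} {p : P} (h : ForcesEq a b p) (h' : ForcesEq b c p) :
    ForcesEq a c p := by
  induction a generalizing b c p with
  | mk ι x r ih =>
    cases b; cases c
    refine ⟨fun i q hq hi => ?_, fun k q hq hk => ?_⟩
    · obtain ⟨q₁, hq₁, j, hj, e⟩ := h.1 i q hq hi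
      obtain ⟨q₂, hq₂, k, hk, e'⟩ := h'.1 j q₁ (hq₁.trans hq) hj
      exact ⟨q₂, hq₂.trans hq₁, k, hk, ih _ (e.mono hq₂) e'⟩
    · obtain ⟨q₁, hq₁, j, hj, e⟩ := h'.2 k q hq hk
      obtain ⟨q₂, hq₂, i, hi, e'⟩ := h.2 j q₁ (hq₁.trans hq) hj
      exact ⟨q₂, hq₂.trans hq₁, i, hi, ih _ e' (e.mono hq₂)⟩

theorem ForcesMem.mono {a b : PName P} {p q : P} (h : ForcesMem a b p) (hq : q ≤ p) :
    ForcesMem a b q := by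
  cases b
  exact fun r hr => h r (hr.trans hq)

theorem ForcesMem.of_dense {a b : PName P} {p : P}
    (h : ∀ q ≤ p, ∃ r ≤ q, ForcesMem a b r) : ForcesMem a b p := by
  cases b
  intro q hq
  obtain ⟨r, hr, hab⟩ := h q hq
  obtain ⟨s, hs, w⟩ := hab r le_rfl
  exact ⟨s, hs.trans hr, w⟩

theorem ForcesMem.congr {a a' b b' : PName P} {p : P} (ha : ForcesEq a a' p)
    (hb : ForcesEq b b' p) (h : ForcesMem a b p) : ForcesMem a' b' p := by
  cases b; cases b'
  intro q hq
  obtain ⟨q₁, hq₁, j, hj, e⟩ := h q hq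
  obtain ⟨q₂, hq₂, k, hk, e'⟩ := hb.1 j q₁ (hq₁.trans hq) hj
  exact ⟨q₂, hq₂.trans hq₁, k, hk,
    ((ha.mono (hq₂.trans (hq₁.trans hq))).symm.trans (e.mono hq₂)).trans e'⟩

theorem forcesMem_mk {ι : Type u} {x : ι → PName P} {r : ι → P} {i : ι} {p : P} (h : p ≤ r i) :
    ForcesMem (x i) (mk ι x r) p :=
  fun q hq => ⟨q, le_rfl, i, hq.trans h, ForcesEq.refl _ _⟩

variable {n : ℕ} {φ ψ : Fml n} {v : Fin n → PName P} {p : P}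

theorem Forces.mono {q : P} (h : Forces φ v p) (hq : q ≤ p) : Forces φ v q := by
  induction φ with
  | falsum => exact h
  | equal => exact ForcesEq.mono h hq
  | rel R ts => cases R; exact ForcesMem.mono h hq
  | imp φ ψ => exact fun r hr => h r (hr.trans hq)
  | all φ ih => exact fun x => ih (h x)

/-- Density is built into the atomic clauses, and implication and `∀` inherit it from their
components. This is what makes the relation classical: a condition that does not force `φ` has an
extension none of whose extensions does. -/
theorem Forces.of_dense (h : ∀ q ≤ p, ∃ r ≤ q, Forces φ v r) : Forces φ v p := by
  induction φ generalizing p with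
  | falsum => obtain ⟨_, _, h⟩ := h p le_rfl; exact h
  | equal => exact ForcesEq.of_dense h
  | rel R ts => cases R; exact ForcesMem.of_dense h
  | imp φ ψ _ ih =>
    intro q hq hφ
    refine ih fun q' hq' => ?_
    obtain ⟨r, hr, w⟩ := h q' (hq'.trans hq)
    exact ⟨r, hr, w r le_rfl (hφ.mono (hr.trans hq'))⟩
  | all φ ih => exact fun x => ih fun q hq => (h q hq).imp fun r hr => ⟨hr.1, hr.2 x⟩

/-- If a condition does not force `φ`, an extension of it forces the negation of `φ`. -/
theorem exists_forces_not (h : ¬ Forces φ v p) : ∃ q ≤ p, ∀ r ≤ q, ¬ Forces φ v r := by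
  by_contra! H
  exact h (Forces.of_dense H)

theorem ofTerm_congr {w : Fin n → PName P} (h : ∀ i, ForcesEq (v i) (w i) p)
    (t : setLang.Term (Empty ⊕ Fin n)) : ForcesEq (ofTerm v t) (ofTerm w t) p := by
  match t with
  | .var (.inr i) => exact h i
  | .var (.inl e) => exact nomatch e
  | .func f _ => exact nomatch f

theorem Forces.congr {w : Fin n → PName P} (h : ∀ i, ForcesEq (v i) (w i) p)
    (hφ : Forces φ v p) : Forces φ w p := by
  induction φ generalizing p with
  | falsum => exact hφ
  | equal a b =>
    exact ((ofTerm_congr h a).symm.trans (show ForcesEq _ _ _ from hφ)).trans (ofTerm_congr h b)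
  | rel R ts => cases R; exact ForcesMem.congr (ofTerm_congr h _) (ofTerm_congr h _) hφ
  | imp φ ψ ih₁ ih₂ =>
    exact fun q hq hw => ih₂ (fun i => (h i).mono hq)
      (hφ q hq (ih₁ (fun i => ((h i).mono hq).symm) hw))
  | all φ ih =>
    refine fun x => ih (fun i => ?_) (hφ x)
    refine Fin.lastCases ?_ (fun i => ?_) i
    · simpa using ForcesEq.refl x p
    · simpa using h i

/-! ### The forcing relation and the logical connectives -/

@[simp]
theorem forces_imp : Forces (φ.imp ψ) v p ↔ ∀ q ≤ p, Forces φ v q → Forces ψ v q := Iff.rfl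

@[simp]
theorem forces_not : Forces (∼φ) v p ↔ ∀ q ≤ p, ¬ Forces φ v q := Iff.rfl

-- Conjunction abbreviates `¬(φ → ¬ψ)`, which by itself only says that `φ` and `ψ` are forced
-- densely; closure under density removes the detour.
@[simp]
theorem forces_inf : Forces (φ ⊓ ψ) v p ↔ Forces φ v p ∧ Forces ψ v p := by
  change (∀ q ≤ p, (∀ r ≤ q, Forces φ v r → ∀ s ≤ r, ¬ Forces ψ v s) → False) ↔ _
  constructor
  · intro h
    constructor
    · by_contra hc
      obtain ⟨q, hq, hn⟩ := exists_forces_not hc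
      exact h q hq fun r hr hφ => absurd hφ (hn r hr)
    · by_contra hc
      obtain ⟨q, hq, hn⟩ := exists_forces_not hc
      exact h q hq fun r hr _ s hs => hn s (hs.trans hr)
  · exact fun h q hq H => H q le_rfl (h.1.mono hq) q le_rfl (h.2.mono hq)

@[simp]
theorem forces_sup :
    Forces (φ ⊔ ψ) v p ↔ ∀ q ≤ p, ∃ r ≤ q, Forces φ v r ∨ Forces ψ v r := by
  change (∀ q ≤ p, (∀ r ≤ q, ¬ Forces φ v r) → Forces ψ v q) ↔ _
  constructor
  · intro h q hq
    by_cases H : ∀ r ≤ q, ¬ Forces φ v r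
    · exact ⟨q, le_rfl, .inr (h q hq H)⟩
    · push Not at H
      obtain ⟨r, hr, hφ⟩ := H
      exact ⟨r, hr, .inl hφ⟩
  · intro h q hq H
    refine Forces.of_dense fun q' hq' => ?_
    obtain ⟨r, hr, hφ | hψ⟩ := h q' (hq'.trans hq)
    · exact absurd hφ (H r (hr.trans hq'))
    · exact ⟨r, hr, hψ⟩

@[simp]
theorem forces_iff :
    Forces (φ ⇔ ψ) v p ↔ ∀ q ≤ p, (Forces φ v q ↔ Forces ψ v q) := by
  unfold BoundedFormula.iff
  simp only [forces_inf, forces_imp]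
  exact ⟨fun h q hq => ⟨h.1 q hq, h.2 q hq⟩,
    fun h => ⟨fun q hq => (h q hq).1, fun q hq => (h q hq).2⟩⟩

@[simp]
theorem forces_all {φ : Fin (n + 1) → Fml (n + 1)} :
    Forces (Fml.all φ) v p ↔ ∀ x : PName P, Forces (φ (Fin.last n)) (Fin.snoc v x) p := Iff.rfl

-- Witnesses are found only densely; names are never mixed along antichains, so no single witness is
-- claimed at `p` itself.
@[simp]
theorem forces_ex {φ : Fin (n + 1) → Fml (n + 1)} :
    Forces (Fml.ex φ) v p ↔
      ∀ q ≤ p, ∃ r ≤ q, ∃ x : PName P, Forces (φ (Fin.last n)) (Fin.snoc v x) r := by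
  change (∀ q ≤ p, ¬ ∀ x, ∀ r ≤ q, ¬ Forces (φ (Fin.last n)) (Fin.snoc v x) r) ↔ _
  refine forall₂_congr fun q hq => ?_
  push Not
  exact ⟨fun ⟨x, r, hr, h⟩ => ⟨r, hr, x, h⟩, fun ⟨r, hr, x, h⟩ => ⟨x, r, hr, h⟩⟩

@[simp]
theorem forces_mem {x y : Fin n} : Forces (Fml.mem x y) v p ↔ ForcesMem (v x) (v y) p := Iff.rfl

@[simp]
theorem forces_eq {x y : Fin n} : Forces (Fml.eq x y) v p ↔ ForcesEq (v x) (v y) p := Iff.rfl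

@[simp]
theorem forces_ball {a : Fin n} {φ : Fin (n + 1) → Fml (n + 1)} :
    Forces (Fml.ball a φ) v p ↔ ∀ x : PName P, ∀ q ≤ p, ForcesMem x (v a) q →
      Forces (φ (Fin.last n)) (Fin.snoc v x) q := by
  simp [Fml.ball]

@[simp]
theorem forces_bex {a : Fin n} {φ : Fin (n + 1) → Fml (n + 1)} :
    Forces (Fml.bex a φ) v p ↔ ∀ q ≤ p, ∃ r ≤ q, ∃ x : PName P, ForcesMem x (v a) r ∧
      Forces (φ (Fin.last n)) (Fin.snoc v x) r := by
  simp [Fml.bex]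

end PName

end ForcingBasics

/-! ### Projections, translation of names, and absoluteness. -/

section Projections

open FirstOrder FirstOrder.Language

/-- A projection of forcing notions: a monotone map `π : Q → P` such that every extension of `π d`
lies above `π d'` for some `d' ≤ d`. -/
structure IsProjection {P Q : Type u} [Preorder P] [Preorder Q] (π : Q → P) : Prop where
  mono : Monotone π
  lift : ∀ d, ∀ p ≤ π d, ∃ d' ≤ d, π d' ≤ p

namespace PName

variable {P Q : Type u} [Preorder P] [Preorder Q]

/-- The translation of `P`-names into `Q`-names along a map `π : Q → P`. -/
def pull (π : Q → P) : PName P → PName Q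
  | ⟨ι, x, r⟩ => ⟨{i : ι × Q // π i.2 ≤ r i.1}, fun i => pull π (x i.1.1), fun i => i.1.2⟩

variable {π : Q → P} (hπ : IsProjection π)

include hπ

/-- A `Q`-generic filter generates a `P`-generic one through `π`, and the pulled name has the same
value as the original. In the induction, `lift` carries conditions below `π d` back below `d`, and
monotonicity carries conditions forward. -/
theorem forcesEq_pull {a b : PName P} {d : Q} :
    ForcesEq (pull π a) (pull π b) d ↔ ForcesEq a b (π d) := by
  induction a generalizing b d with
  | mk ι x r ih =>
    obtain ⟨κ, y, s⟩ := b
    constructor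
    · intro h
      constructor
      · intro i q hq hi
        obtain ⟨d₁, hd₁, hq₁⟩ := hπ.lift d q hq
        obtain ⟨d₂, hd₂, ⟨⟨j, e⟩, hj⟩, hje, w⟩ := h.1 ⟨(i, d₁), hq₁.trans hi⟩ d₁ hd₁ le_rfl
        exact ⟨π d₂, (hπ.mono hd₂).trans hq₁, j, (hπ.mono hje).trans hj, (ih i).1 w⟩
      · intro j q hq hj
        obtain ⟨d₁, hd₁, hq₁⟩ := hπ.lift d q hq
        obtain ⟨d₂, hd₂, ⟨⟨i, e⟩, hi⟩, hie, w⟩ := h.2 ⟨(j, d₁), hq₁.trans hj⟩ d₁ hd₁ le_rfl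
        exact ⟨π d₂, (hπ.mono hd₂).trans hq₁, i, (hπ.mono hie).trans hi, (ih i).1 w⟩
    · intro h
      constructor
      · rintro ⟨⟨i, e⟩, hi⟩ d₁ hd₁ he
        obtain ⟨q, hq, j, hj, w⟩ := h.1 i (π d₁) (hπ.mono hd₁) ((hπ.mono he).trans hi)
        obtain ⟨d₂, hd₂, hq₂⟩ := hπ.lift d₁ q hq
        exact ⟨d₂, hd₂, ⟨(j, d₂), hq₂.trans hj⟩, le_rfl, (ih i).2 (w.mono hq₂)⟩
      · rintro ⟨⟨j, e⟩, hj⟩ d₁ hd₁ he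
        obtain ⟨q, hq, i, hi, w⟩ := h.2 j (π d₁) (hπ.mono hd₁) ((hπ.mono he).trans hj)
        obtain ⟨d₂, hd₂, hq₂⟩ := hπ.lift d₁ q hq
        exact ⟨d₂, hd₂, ⟨(i, d₂), hq₂.trans hi⟩, le_rfl, (ih i).2 (w.mono hq₂)⟩

theorem forcesMem_pull {a b : PName P} {d : Q} :
    ForcesMem (pull π a) (pull π b) d ↔ ForcesMem a b (π d) := by
  obtain ⟨κ, y, s⟩ := b
  constructor
  · intro h q hq
    obtain ⟨d₁, hd₁, hq₁⟩ := hπ.lift d q hq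
    obtain ⟨d₂, hd₂, ⟨⟨j, e⟩, hj⟩, hje, w⟩ := h d₁ hd₁
    exact ⟨π d₂, (hπ.mono hd₂).trans hq₁, j, (hπ.mono hje).trans hj, (forcesEq_pull hπ).1 w⟩
  · intro h d₁ hd₁
    obtain ⟨q, hq, j, hj, w⟩ := h (π d₁) (hπ.mono hd₁)
    obtain ⟨d₂, hd₂, hq₂⟩ := hπ.lift d₁ q hq
    exact ⟨d₂, hd₂, ⟨(j, d₂), hq₂.trans hj⟩, le_rfl, (forcesEq_pull hπ).2 (w.mono hq₂)⟩

omit hπ in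
theorem pull_check (x : PSet.{u}) (d : Q) : ForcesEq (pull π (check P x)) (check Q x) d := by
  induction x generalizing d with
  | mk ι A ih =>
    refine ⟨?_, ?_⟩
    · rintro ⟨⟨⟨i, p⟩, e⟩, hi⟩ d₁ hd₁ he
      exact ⟨d₁, le_rfl, (i, d₁), le_rfl, ih i d₁⟩
    · rintro ⟨i, e⟩ d₁ hd₁ he
      exact ⟨d₁, le_rfl, ⟨((i, π d₁), d₁), le_rfl⟩, le_rfl, ih i d₁⟩

omit hπ in
-- The smaller extension is transitive in the larger: a member of a pulled name is, below some
-- extension, itself given by a pulled name. This is why bounded quantifiers are absolute.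
theorem exists_of_forcesMem_pull (hm : Monotone π) {a : PName Q} {b : PName P} {d : Q}
    (h : ForcesMem a (pull π b) d) :
    ∃ d' ≤ d, ∃ y : PName P, ForcesMem y b (π d') ∧ ForcesEq a (pull π y) d' := by
  obtain ⟨κ, y, s⟩ := b
  obtain ⟨d₁, hd₁, ⟨⟨j, e⟩, hj⟩, hje, w⟩ := h d le_rfl
  exact ⟨d₁, hd₁, y j, forcesMem_mk ((hm hje).trans hj), w⟩

variable {n : ℕ}

omit hπ in
theorem snoc_congr {v : Fin n → PName P} {x y : PName P} {p : P} (h : ForcesEq x y p)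
    (i : Fin (n + 1)) :
    ForcesEq ((Fin.snoc v x : Fin (n + 1) → PName P) i)
      ((Fin.snoc v y : Fin (n + 1) → PName P) i) p := by
  refine Fin.lastCases ?_ (fun i => ?_) i
  · simpa using h
  · simpa using ForcesEq.refl (v i) p

/-- `φ` is absolute between the extensions by `P` and `Q`. -/
def Absolute (π : Q → P) (φ : Fml n) : Prop :=
  ∀ v d, Forces φ (pull π ∘ v) d ↔ Forces φ v (π d)

/-- `φ` goes up from the extension by `P` to the extension by `Q`. -/
def Upward (π : Q → P) (φ : Fml n) : Prop :=
  ∀ v d, Forces φ v (π d) → Forces φ (pull π ∘ v) d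

omit hπ in
theorem Absolute.upward {φ : Fml n} (h : Absolute π φ) : Upward π φ := fun v d => (h v d).2

theorem absolute_mem (x y : Fin n) : Absolute π (Fml.mem x y) :=
  fun _ _ => forcesMem_pull hπ

theorem absolute_eq (x y : Fin n) : Absolute π (Fml.eq x y) :=
  fun _ _ => forcesEq_pull hπ

theorem Absolute.imp {φ ψ : Fml n} (h₁ : Absolute π φ) (h₂ : Absolute π ψ) :
    Absolute π (φ.imp ψ) := by
  refine fun v d => ⟨fun h p hp hφ => Forces.of_dense fun q hq => ?_, fun h d' hd' hφ => ?_⟩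
  · obtain ⟨d', hd', hq'⟩ := hπ.lift d q (hq.trans hp)
    exact ⟨π d', hq', (h₂ v d').1 (h d' hd' ((h₁ v d').2 (hφ.mono (hq'.trans hq))))⟩
  · exact (h₂ v d').2 (h _ (hπ.mono hd') ((h₁ v d').1 hφ))

omit hπ in
theorem absolute_falsum : Absolute π (BoundedFormula.falsum : Fml n) := fun _ _ => Iff.rfl

theorem Absolute.not {φ : Fml n} (h : Absolute π φ) : Absolute π (∼φ) :=
  h.imp hπ absolute_falsum

omit hπ in
theorem Absolute.inf {φ ψ : Fml n} (h₁ : Absolute π φ) (h₂ : Absolute π ψ) :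
    Absolute π (φ ⊓ ψ) := by
  intro v d
  rw [forces_inf, forces_inf, h₁ v d, h₂ v d]

theorem Absolute.sup {φ ψ : Fml n} (h₁ : Absolute π φ) (h₂ : Absolute π ψ) :
    Absolute π (φ ⊔ ψ) :=
  (h₁.not hπ).imp hπ h₂

theorem Absolute.iff {φ ψ : Fml n} (h₁ : Absolute π φ) (h₂ : Absolute π ψ) :
    Absolute π (φ ⇔ ψ) :=
  (h₁.imp hπ h₂).inf (h₂.imp hπ h₁)

omit hπ in
theorem Upward.inf {φ ψ : Fml n} (h₁ : Upward π φ) (h₂ : Upward π ψ) : Upward π (φ ⊓ ψ) := by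
  intro v d
  rw [forces_inf, forces_inf]
  exact fun h => ⟨h₁ v d h.1, h₂ v d h.2⟩

theorem Upward.ball {a : Fin n} {φ : Fin (n + 1) → Fml (n + 1)}
    (h : Upward π (φ (Fin.last n))) : Upward π (Fml.ball a φ) := by
  intro v d H
  rw [forces_ball] at H ⊢
  intro x d₁ hd₁ hx
  refine Forces.of_dense fun d₂ hd₂ => ?_
  obtain ⟨d₃, hd₃, y, hy, e⟩ := exists_of_forcesMem_pull hπ.mono (hx.mono hd₂)
  have := h _ _ (H y _ (hπ.mono (hd₃.trans (hd₂.trans hd₁))) hy)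
  rw [Fin.comp_snoc] at this
  exact ⟨d₃, hd₃, this.congr (snoc_congr e.symm)⟩

theorem Upward.ex {φ : Fin (n + 1) → Fml (n + 1)}
    (h : Upward π (φ (Fin.last n))) : Upward π (Fml.ex φ) := by
  intro v d H
  rw [forces_ex] at H ⊢
  intro d₁ hd₁
  obtain ⟨q, hq, x, hx⟩ := H _ (hπ.mono hd₁)
  obtain ⟨d₂, hd₂, hq₂⟩ := hπ.lift d₁ q hq
  have := h _ _ (hx.mono hq₂)
  rw [Fin.comp_snoc] at this
  exact ⟨d₂, hd₂, _, this⟩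

theorem Upward.bex {a : Fin n} {φ : Fin (n + 1) → Fml (n + 1)}
    (h : Upward π (φ (Fin.last n))) : Upward π (Fml.bex a φ) :=
  Upward.ex hπ ((absolute_mem hπ _ _).upward.inf h)

theorem Absolute.ball {a : Fin n} {φ : Fin (n + 1) → Fml (n + 1)}
    (h : Absolute π (φ (Fin.last n))) : Absolute π (Fml.ball a φ) := by
  refine fun v d => ⟨fun H => ?_, h.upward.ball hπ v d⟩
  rw [forces_ball] at H ⊢
  intro x p hp hx
  refine Forces.of_dense fun q hq => ?_
  obtain ⟨d₁, hd₁, hq₁⟩ := hπ.lift d q (hq.trans hp)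
  have := H (pull π x) d₁ hd₁ ((forcesMem_pull hπ).2 (hx.mono (hq₁.trans hq)))
  rw [← Fin.comp_snoc] at this
  exact ⟨π d₁, hq₁, (h _ _).1 this⟩

theorem Absolute.bex {a : Fin n} {φ : Fin (n + 1) → Fml (n + 1)}
    (h : Absolute π (φ (Fin.last n))) : Absolute π (Fml.bex a φ) := by
  refine fun v d => ⟨fun H => ?_, h.upward.bex hπ v d⟩
  rw [forces_bex] at H ⊢
  intro p hp
  obtain ⟨d₁, hd₁, hq₁⟩ := hπ.lift d p hp
  obtain ⟨d₂, hd₂, x, hx, hφ⟩ := H d₁ hd₁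
  obtain ⟨d₃, hd₃, y, hy, e⟩ := exists_of_forcesMem_pull hπ.mono hx
  have := (hφ.mono hd₃).congr (snoc_congr e)
  rw [← Fin.comp_snoc] at this
  exact ⟨π d₃, (hπ.mono (hd₃.trans hd₂)).trans hq₁, y, hy, (h _ _).1 this⟩

/-! ### Absoluteness of the formulas occurring in the tree property. -/

theorem absolute_isUPair (w x y : Fin n) : Absolute π (Fml.isUPair w x y) := by
  unfold Fml.isUPair
  with_reducible repeat' first
    | exact absolute_mem hπ _ _ | exact absolute_eq hπ _ _
    | apply Absolute.ball hπ | apply Absolute.inf | apply Absolute.sup hπ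

theorem absolute_isPair (z x y : Fin n) : Absolute π (Fml.isPair z x y) := by
  unfold Fml.isPair
  with_reducible repeat' first
    | exact absolute_isUPair hπ _ _ _
    | apply Absolute.ball hπ | apply Absolute.bex hπ | apply Absolute.inf
    | apply Absolute.sup hπ

theorem absolute_pairMem (r x y : Fin n) : Absolute π (Fml.pairMem r x y) := by
  unfold Fml.pairMem
  with_reducible repeat' first
    | exact absolute_isPair hπ _ _ _
    | apply Absolute.bex hπ

theorem absolute_isFunc (f A B : Fin n) : Absolute π (Fml.isFunc f A B) := by
  unfold Fml.isFunc
  with_reducible repeat' first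
    | exact absolute_pairMem hπ _ _ _ | exact absolute_eq hπ _ _ | exact absolute_isPair hπ _ _ _
    | apply Absolute.ball hπ | apply Absolute.bex hπ | apply Absolute.inf
    | apply Absolute.imp hπ

theorem absolute_isInj (f A B : Fin n) : Absolute π (Fml.isInj f A B) := by
  unfold Fml.isInj
  with_reducible repeat' first
    | exact absolute_pairMem hπ _ _ _ | exact absolute_eq hπ _ _
    | apply Absolute.ball hπ | apply Absolute.imp hπ

theorem absolute_isSurj (f A B : Fin n) : Absolute π (Fml.isSurj f A B) := by
  unfold Fml.isSurj
  with_reducible repeat' first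
    | exact absolute_pairMem hπ _ _ _
    | apply Absolute.ball hπ | apply Absolute.bex hπ

theorem absolute_isPartialOrder (T R : Fin n) : Absolute π (Fml.isPartialOrder T R) := by
  unfold Fml.isPartialOrder
  with_reducible repeat' first
    | exact absolute_pairMem hπ _ _ _ | exact absolute_eq hπ _ _
    | apply Absolute.ball hπ | apply Absolute.inf | apply Absolute.imp hπ

theorem absolute_isPredSet (A T R t : Fin n) : Absolute π (Fml.isPredSet A T R t) := by
  unfold Fml.isPredSet
  with_reducible repeat' first
    | exact absolute_pairMem hπ _ _ _ | exact absolute_eq hπ _ _ | exact absolute_mem hπ _ _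
    | apply Absolute.ball hπ | apply Absolute.inf | apply Absolute.not hπ
    | apply Absolute.imp hπ

/-- The set of predecessors and the isomorphism are quantified without bound, so a level computed in
the smaller extension persists, while the converse is not immediate. -/
theorem upward_isLevel (T R t α : Fin n) : Upward π (Fml.isLevel T R t α) := by
  unfold Fml.isLevel
  with_reducible repeat' first
    | exact absolute_mem hπ _ _ | exact absolute_eq hπ _ _ | exact absolute_pairMem hπ _ _ _
    | exact absolute_isPredSet hπ _ _ _ _ | exact absolute_isFunc hπ _ _ _
    | exact absolute_isInj hπ _ _ _ | exact absolute_isSurj hπ _ _ _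
    | apply Upward.ex hπ | apply Upward.inf
    | apply Absolute.upward
    | apply Absolute.ball hπ | apply Absolute.inf | apply Absolute.sup hπ
    | apply Absolute.iff hπ | apply Absolute.imp hπ

theorem upward_cardLT (L κ : Fin n) : Upward π (Fml.cardLT L κ) := by
  unfold Fml.cardLT
  with_reducible repeat' first
    | exact absolute_isFunc hπ _ _ _ | exact absolute_isInj hπ _ _ _
    | apply Upward.bex hπ | apply Upward.ex hπ
    | apply Absolute.upward
    | apply Absolute.inf

theorem upward_levelsCofinal (X T R κ : Fin n) : Upward π (Fml.levelsCofinal X T R κ) := by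
  unfold Fml.levelsCofinal
  with_reducible repeat' first
    | exact absolute_mem hπ _ _ | exact absolute_eq hπ _ _ | exact upward_isLevel hπ _ _ _ _
    | apply Upward.ball hπ | apply Upward.bex hπ | apply Upward.inf
    | apply Absolute.upward
    | apply Absolute.sup hπ

end PName

end Projections

/-! ### Canonical names of ordinals, and uniqueness of levels. -/

section Ordinals

open FirstOrder FirstOrder.Language

theorem Ordinal.toPSet_equiv_iff {α β : Ordinal.{u}} :
    PSet.Equiv α.toPSet β.toPSet ↔ α = β := by
  rw [← ZFSet.eq, Ordinal.mk_toPSet, Ordinal.mk_toPSet, Ordinal.toZFSet_injective.eq_iff]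

theorem Ordinal.toPSet_mem_toPSet_iff {α β : Ordinal.{u}} : α.toPSet ∈ β.toPSet ↔ α < β := by
  rw [← ZFSet.mk_mem_iff, Ordinal.mk_toPSet, Ordinal.mk_toPSet, Ordinal.toZFSet_mem_toZFSet_iff]

namespace PName

variable {P : Type u} [Preorder P]

theorem forcesEq_check {x y : PSet.{u}} {p : P} :
    ForcesEq (check P x) (check P y) p ↔ PSet.Equiv x y := by
  induction x generalizing y p with
  | mk ι A ih =>
    obtain ⟨κ, B⟩ := y
    constructor
    · intro h
      refine ⟨fun i => ?_, fun j => ?_⟩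
      · obtain ⟨q, _, j, _, e⟩ := h.1 (i, p) p le_rfl le_rfl
        exact ⟨j.1, (ih i).1 e⟩
      · obtain ⟨q, _, i, _, e⟩ := h.2 (j, p) p le_rfl le_rfl
        exact ⟨i.1, (ih i.1).1 e⟩
    · intro h
      refine ⟨fun i q _ _ => ?_, fun j q _ _ => ?_⟩
      · obtain ⟨j, hj⟩ := h.1 i.1
        exact ⟨q, le_rfl, (j, q), le_rfl, (ih i.1).2 hj⟩
      · obtain ⟨i, hi⟩ := h.2 j.1
        exact ⟨q, le_rfl, (i, q), le_rfl, (ih i).2 hi⟩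

theorem forcesMem_check {x y : PSet.{u}} {p : P} :
    ForcesMem (check P x) (check P y) p ↔ x ∈ y := by
  obtain ⟨κ, B⟩ := y
  constructor
  · intro h
    obtain ⟨q, _, j, _, e⟩ := h p le_rfl
    exact ⟨j.1, forcesEq_check.1 e⟩
  · rintro ⟨j, hj⟩ q _
    exact ⟨q, le_rfl, (j, q), le_rfl, forcesEq_check.2 hj⟩

theorem exists_of_forcesMem_check {a : PName P} {y : PSet.{u}} {p : P}
    (h : ForcesMem a (check P y) p) : ∃ q ≤ p, ∃ x ∈ y, ForcesEq a (check P x) q := by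
  obtain ⟨κ, B⟩ := y
  obtain ⟨q, hq, j, _, e⟩ := h p le_rfl
  exact ⟨q, hq, B j.1, ⟨j.1, PSet.Equiv.refl _⟩, e⟩

/-- The canonical name of an ordinal. -/
noncomputable abbrev ord (P : Type u) (α : Ordinal.{u}) : PName P := check P α.toPSet

theorem forcesEq_ord {α β : Ordinal.{u}} {p : P} : ForcesEq (ord P α) (ord P β) p ↔ α = β :=
  forcesEq_check.trans Ordinal.toPSet_equiv_iff

theorem forcesMem_ord {α β : Ordinal.{u}} {p : P} : ForcesMem (ord P α) (ord P β) p ↔ α < β :=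
  forcesMem_check.trans Ordinal.toPSet_mem_toPSet_iff

theorem exists_of_forcesMem_ord {a : PName P} {β : Ordinal.{u}} {p : P}
    (h : ForcesMem a (ord P β) p) : ∃ q ≤ p, ∃ α < β, ForcesEq a (ord P α) q := by
  obtain ⟨q, hq, x, hx, e⟩ := exists_of_forcesMem_check h
  obtain ⟨α, hα, e'⟩ := Ordinal.mem_toPSet_iff.1 hx
  exact ⟨q, hq, α, hα, e.trans (forcesEq_check.2 e')⟩

/-! ### Pairs and levels -/

/-- `p ⊩ (x, y) ∈ r`. -/
def ForcesPair (r x y : PName P) (p : P) : Prop :=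
  Forces (Fml.pairMem (0 : Fin 3) 1 2) ![r, x, y] p

/-- `p` forces that `t` has level `α` in `(T, R)`. -/
def ForcesLevel (T R t α : PName P) (p : P) : Prop :=
  Forces (Fml.isLevel (0 : Fin 4) 1 2 3) ![T, R, t, α] p

variable {n : ℕ} {v : Fin n → PName P} {p q : P}

omit [Preorder P] in
@[simp]
theorem snoc_castSucc_apply (x : PName P) (i : Fin n) :
    (Fin.snoc v x : Fin (n + 1) → PName P) i.castSucc = v i := Fin.snoc_castSucc ..

omit [Preorder P] in
@[simp]
theorem snoc_last_apply (x : PName P) :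
    (Fin.snoc v x : Fin (n + 1) → PName P) (Fin.last n) = x := Fin.snoc_last ..

-- Only the values of the variables matter. This reduces occurrences under quantifiers to one fixed
-- formula, so that later arguments can work with names instead of indices.
@[simp]
theorem forces_pairMem {r x y : Fin n} :
    Forces (Fml.pairMem r x y) v p ↔ ForcesPair (v r) (v x) (v y) p := by
  unfold ForcesPair
  simp only [Fml.pairMem, Fml.isPair, Fml.isUPair, forces_bex, forces_ball, forces_inf, forces_sup,
    forces_mem, forces_eq, snoc_castSucc_apply, snoc_last_apply]
  rfl

@[simp]
theorem forces_isLevel {T R t α : Fin n} :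
    Forces (Fml.isLevel T R t α) v p ↔ ForcesLevel (v T) (v R) (v t) (v α) p := by
  unfold ForcesLevel
  simp only [Fml.isLevel, Fml.isPredSet, Fml.isFunc, Fml.isInj, Fml.isSurj, Fml.isPair,
    Fml.isUPair, forces_bex, forces_ball, forces_inf, forces_sup, forces_ex, forces_imp, forces_not,
    forces_iff, forces_pairMem, forces_mem, forces_eq, snoc_castSucc_apply, snoc_last_apply]
  rfl

theorem ForcesPair.mono {r x y : PName P} (h : ForcesPair r x y p) (hq : q ≤ p) :
    ForcesPair r x y q := Forces.mono h hq

theorem ForcesPair.of_dense {r x y : PName P} (h : ∀ q ≤ p, ∃ q' ≤ q, ForcesPair r x y q') :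
    ForcesPair r x y p := Forces.of_dense h

theorem ForcesPair.congr {r r' x x' y y' : PName P} (hr : ForcesEq r r' p) (hx : ForcesEq x x' p)
    (hy : ForcesEq y y' p) (h : ForcesPair r x y p) : ForcesPair r' x' y' p := by
  refine Forces.congr (fun i => ?_) h
  match i with
  | 0 => exact hr
  | 1 => exact hx
  | 2 => exact hy

theorem ForcesLevel.mono {T R t α : PName P} (h : ForcesLevel T R t α p) (hq : q ≤ p) :
    ForcesLevel T R t α q := Forces.mono h hq

theorem ForcesLevel.congr {T T' R R' t t' α α' : PName P} (hT : ForcesEq T T' p)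
    (hR : ForcesEq R R' p) (ht : ForcesEq t t' p) (hα : ForcesEq α α' p)
    (h : ForcesLevel T R t α p) : ForcesLevel T' R' t' α' p := by
  refine Forces.congr (fun i => ?_) h
  match i with
  | 0 => exact hT
  | 1 => exact hR
  | 2 => exact ht
  | 3 => exact hα

/-- `p` forces that `A = {s ∈ T | s < t}`. -/
structure IsPredSet (A T R t : PName P) (p : P) : Prop where
  sub : ∀ s, ∀ q ≤ p, ForcesMem s A q →
    ForcesMem s T q ∧ ForcesPair R s t q ∧ ∀ r ≤ q, ¬ ForcesEq s t r
  mem : ∀ s, ∀ q ≤ p, ForcesMem s T q → ForcesPair R s t q → (∀ r ≤ q, ¬ ForcesEq s t r) →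
    ForcesMem s A q

/-- `p` forces that `f` is an isomorphism of `(A, R)` with the ordinal `γ`. -/
structure IsLevelIso (f A R : PName P) (γ : Ordinal.{u}) (p : P) : Prop where
  total : ∀ s, ∀ q ≤ p, ForcesMem s A q → ∃ r ≤ q, ∃ β < γ, ForcesPair f s (ord P β) r
  func : ∀ s, ∀ q ≤ p, ForcesMem s A q → ∀ β < γ, ∀ β' < γ, ForcesPair f s (ord P β) q →
    ForcesPair f s (ord P β') q → β = β'
  inj : ∀ s s', ∀ q ≤ p, ForcesMem s A q → ForcesMem s' A q → ∀ β < γ,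
    ForcesPair f s (ord P β) q → ForcesPair f s' (ord P β) q → ForcesEq s s' q
  surj : ∀ β < γ, ∀ q ≤ p, ∃ r ≤ q, ∃ s, ForcesMem s A r ∧ ForcesPair f s (ord P β) r
  iso : ∀ s s', ∀ q ≤ p, ForcesMem s A q → ForcesMem s' A q → ∀ β < γ, ∀ β' < γ,
    ForcesPair f s (ord P β) q → ForcesPair f s' (ord P β') q → (ForcesPair R s s' q ↔ β ≤ β')

theorem IsPredSet.mono {A T R t : PName P} (h : IsPredSet A T R t p) (hq : q ≤ p) :
    IsPredSet A T R t q :=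
  ⟨fun s r hr => h.sub s r (hr.trans hq), fun s r hr => h.mem s r (hr.trans hq)⟩

theorem IsLevelIso.mono {f A R : PName P} {γ : Ordinal.{u}} (h : IsLevelIso f A R γ p)
    (hq : q ≤ p) : IsLevelIso f A R γ q :=
  ⟨fun s r hr => h.total s r (hr.trans hq), fun s r hr => h.func s r (hr.trans hq),
    fun s s' r hr => h.inj s s' r (hr.trans hq), fun β hβ r hr => h.surj β hβ r (hr.trans hq),
    fun s s' r hr => h.iso s s' r (hr.trans hq)⟩

/-- Members of `ord P γ` are densely equal to canonical names of ordinals, so values of the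
isomorphism can be taken to be genuine ordinals below `γ`. -/
theorem ForcesLevel.exists_iso {T R t : PName P} {γ : Ordinal.{u}}
    (h : ForcesLevel T R t (ord P γ) p) :
    ∃ q ≤ p, ∃ A f, IsPredSet A T R t q ∧ IsLevelIso f A R γ q := by
  unfold ForcesLevel at h
  simp only [Fml.isLevel, Fml.isPredSet, Fml.isFunc, Fml.isInj, Fml.isSurj, forces_bex, forces_ball,
    forces_inf, forces_sup, forces_ex, forces_imp, forces_not, forces_iff, forces_pairMem,
    forces_mem, forces_eq, snoc_castSucc_apply, snoc_last_apply] at h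
  obtain ⟨q, hq, A, ⟨hA₁, hA₂⟩, h⟩ := h p le_rfl
  obtain ⟨r, hr, f, ⟨⟨⟨⟨-, hfA⟩, hff⟩, hfi⟩, hfs⟩, hfo⟩ := h q le_rfl
  -- The indices are concrete, so the remaining variable lookups evaluate by definition.
  change ∀ x, ∀ q ≤ r, ForcesMem x A q → ∀ q' ≤ q, ∃ q'' ≤ q', ∃ y,
    ForcesMem y (ord P γ) q'' ∧ ForcesPair f x y q'' at hfA
  change ∀ y, ∀ q ≤ r, ForcesMem y (ord P γ) q → ∀ q' ≤ q, ∃ q'' ≤ q', ∃ x,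
    ForcesMem x A q'' ∧ ForcesPair f x y q'' at hfs
  change ∀ x, ∀ q ≤ r, ForcesMem x A q → ∀ y, ∀ q' ≤ q, ForcesMem y (ord P γ) q' →
    ∀ y', ∀ q'' ≤ q', ForcesMem y' (ord P γ) q'' → ∀ q₁ ≤ q'', ForcesPair f x y q₁ →
    ∀ q₂ ≤ q₁, ForcesPair f x y' q₂ → ForcesEq y y' q₂ at hff
  change ∀ x, ∀ q ≤ r, ForcesMem x A q → ∀ x', ∀ q' ≤ q, ForcesMem x' A q' →
    ∀ y, ∀ q'' ≤ q', ForcesMem y (ord P γ) q'' → ∀ q₁ ≤ q'', ForcesPair f x y q₁ →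
    ∀ q₂ ≤ q₁, ForcesPair f x' y q₂ → ForcesEq x x' q₂ at hfi
  change ∀ x, ∀ q ≤ r, ForcesMem x A q → ∀ x', ∀ q' ≤ q, ForcesMem x' A q' →
    ∀ y, ∀ q'' ≤ q', ForcesMem y (ord P γ) q'' → ∀ y', ∀ q₁ ≤ q'', ForcesMem y' (ord P γ) q₁ →
    ∀ q₂ ≤ q₁, ForcesPair f x y q₂ → ∀ q₃ ≤ q₂, ForcesPair f x' y' q₃ →
    ∀ q₄ ≤ q₃, (ForcesPair R x x' q₄ ↔ ∀ q₅ ≤ q₄, ∃ q₆ ≤ q₅,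
      ForcesMem y y' q₆ ∨ ForcesEq y y' q₆) at hfo
  refine ⟨r, hr.trans hq, A, f, ⟨fun s q₁ hq₁ => hA₁ s q₁ (hq₁.trans hr),
    fun s q₁ hq₁ hT hR => hA₂ s q₁ (hq₁.trans hr) hT q₁ le_rfl hR q₁ le_rfl⟩, ?_, ?_, ?_, ?_, ?_⟩
  · intro s q₁ hq₁ hs
    obtain ⟨q₂, hq₂, y, hy, hfy⟩ := hfA s q₁ hq₁ hs q₁ le_rfl
    obtain ⟨q₃, hq₃, β, hβ, e⟩ := exists_of_forcesMem_ord hy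
    exact ⟨q₃, hq₃.trans hq₂, β, hβ, (hfy.mono hq₃).congr (.refl _ _) (.refl _ _) e⟩
  · intro s q₁ hq₁ hs β hβ β' hβ' h h'
    exact forcesEq_ord.1 (hff s q₁ hq₁ hs _ q₁ le_rfl (forcesMem_ord.2 hβ) _ q₁ le_rfl
      (forcesMem_ord.2 hβ') q₁ le_rfl h q₁ le_rfl h')
  · intro s s' q₁ hq₁ hs hs' β hβ h h'
    exact hfi s q₁ hq₁ hs s' q₁ le_rfl hs' _ q₁ le_rfl (forcesMem_ord.2 hβ) q₁ le_rfl h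
      q₁ le_rfl h'
  · intro β hβ q₁ hq₁
    exact hfs _ q₁ hq₁ (forcesMem_ord.2 hβ) q₁ le_rfl
  · intro s s' q₁ hq₁ hs hs' β hβ β' hβ' h h'
    rw [hfo s q₁ hq₁ hs s' q₁ le_rfl hs' _ q₁ le_rfl (forcesMem_ord.2 hβ) _ q₁ le_rfl
      (forcesMem_ord.2 hβ') q₁ le_rfl h q₁ le_rfl h' q₁ le_rfl]
    simp only [forcesMem_ord, forcesEq_ord, ← le_iff_lt_or_eq]
    exact ⟨fun H => (H q₁ le_rfl).choose_spec.2, fun H q₂ _ => ⟨q₂, le_rfl, H⟩⟩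

/-- Rigidity of well-orders, by induction on `β`. Suppose `f'` sends `s` to `δ ≠ β`. If `δ < β`, the
node that `f` sends to `δ` is also sent there by `f'`, hence equals `s`. If `β < δ`, the node that
`f'` sends to `β` lies below `s`, so `f` sends it to some `ε ≤ β`; `ε < β` contradicts the induction
hypothesis, and `ε = β` makes it equal to `s`. -/
theorem IsLevelIso.agree {T R t A A' f f' : PName P} {γ γ' : Ordinal.{u}}
    (hA : IsPredSet A T R t p) (hA' : IsPredSet A' T R t p) (hf : IsLevelIso f A R γ p)
    (hf' : IsLevelIso f' A' R γ' p) {β : Ordinal.{u}} (hβ : β < γ) {s : PName P} {q : P}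
    (hq : q ≤ p) (hs : ForcesMem s A q) (hsβ : ForcesPair f s (ord P β) q) :
    ∃ r ≤ q, β < γ' ∧ ForcesPair f' s (ord P β) r := by
  have hAA' : ∀ {s q}, q ≤ p → ForcesMem s A q → ForcesMem s A' q := fun hq h =>
    have := hA.sub _ _ hq h
    hA'.mem _ _ hq this.1 this.2.1 this.2.2
  have hA'A : ∀ {s q}, q ≤ p → ForcesMem s A' q → ForcesMem s A q := fun hq h =>
    have := hA'.sub _ _ hq h
    hA.mem _ _ hq this.1 this.2.1 this.2.2
  induction β using WellFoundedLT.induction generalizing s q with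
  | ind β ih =>
    obtain ⟨q₁, hq₁, δ, hδ, hsδ⟩ := hf'.total s q hq (hAA' hq hs)
    have hq₁p := hq₁.trans hq
    rcases lt_trichotomy δ β with h | rfl | h
    · obtain ⟨q₂, hq₂, s₁, hs₁, hs₁δ⟩ := hf.surj δ (h.trans hβ) q₁ hq₁p
      obtain ⟨q₃, hq₃, -, hs₁δ'⟩ := ih δ h (h.trans hβ) (hq₂.trans hq₁p) hs₁ hs₁δ
      have hq₃p := hq₃.trans (hq₂.trans hq₁p)
      have hs₃ := hs.mono (hq₃.trans (hq₂.trans hq₁))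
      have e := hf'.inj s₁ s q₃ hq₃p (hAA' hq₃p (hs₁.mono hq₃)) (hAA' hq₃p hs₃) δ hδ hs₁δ'
        (hsδ.mono (hq₃.trans hq₂))
      have := hf.func s q₃ hq₃p hs₃ δ (h.trans hβ) β hβ
        ((hs₁δ.mono hq₃).congr (.refl _ _) e (.refl _ _))
        (hsβ.mono (hq₃.trans (hq₂.trans hq₁)))
      exact absurd this h.ne
    · exact ⟨q₁, hq₁, hδ, hsδ⟩
    · obtain ⟨q₂, hq₂, s₁, hs₁, hs₁β⟩ := hf'.surj β (h.trans hδ) q₁ hq₁p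
      have hq₂p := hq₂.trans hq₁p
      have hs₂ := hs.mono (hq₂.trans hq₁)
      have hR := (hf'.iso s₁ s q₂ hq₂p hs₁ (hAA' hq₂p hs₂) β (h.trans hδ) δ hδ hs₁β
        (hsδ.mono hq₂)).2 h.le
      have hs₁A := hA'A hq₂p hs₁
      obtain ⟨q₃, hq₃, ε, hε, hs₁ε⟩ := hf.total s₁ q₂ hq₂p hs₁A
      have hq₃p := hq₃.trans hq₂p
      have hεβ := (hf.iso s₁ s q₃ hq₃p (hs₁A.mono hq₃) (hs₂.mono hq₃) ε hε β hβ hs₁ε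
        (hsβ.mono (hq₃.trans (hq₂.trans hq₁)))).1 (hR.mono hq₃)
      rcases hεβ.lt_or_eq with hlt | rfl
      · obtain ⟨q₄, hq₄, hεγ', hs₁ε'⟩ := ih ε hlt hε hq₃p (hs₁A.mono hq₃) hs₁ε
        exact absurd (hf'.func s₁ q₄ (hq₄.trans hq₃p) (hs₁.mono (hq₄.trans hq₃)) ε hεγ' β
          (h.trans hδ) hs₁ε' (hs₁β.mono (hq₄.trans hq₃))) hlt.ne
      · have e := hf.inj s₁ s q₃ hq₃p (hs₁A.mono hq₃) (hs₂.mono hq₃) ε hε hs₁ε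
          (hsβ.mono (hq₃.trans (hq₂.trans hq₁)))
        exact absurd (hf'.func s q₃ hq₃p (hAA' hq₃p (hs₂.mono hq₃)) ε (h.trans hδ) δ hδ
          ((hs₁β.mono hq₃).congr (.refl _ _) e (.refl _ _)) (hsδ.mono (hq₃.trans hq₂))) h.ne

/-- If `γ' < γ`, the node sent to `γ'` by `f` would be sent to `γ'` by `f'` as well, although the
values of `f'` lie below `γ'`. -/
theorem IsLevelIso.le {T R t A A' f f' : PName P} {γ γ' : Ordinal.{u}}
    (hA : IsPredSet A T R t p) (hA' : IsPredSet A' T R t p) (hf : IsLevelIso f A R γ p)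
    (hf' : IsLevelIso f' A' R γ' p) : γ ≤ γ' := by
  by_contra! h
  obtain ⟨q, hq, s, hs, hsγ⟩ := hf.surj γ' h p le_rfl
  obtain ⟨r, _, hlt, _⟩ := IsLevelIso.agree hA hA' hf hf' h hq hs hsγ
  exact hlt.false

/-- The level of a node is unique. -/
theorem ForcesLevel.unique {T R t : PName P} {γ γ' : Ordinal.{u}}
    (h : ForcesLevel T R t (ord P γ) p) (h' : ForcesLevel T R t (ord P γ') p) : γ = γ' := by
  obtain ⟨q, hq, A, f, hA, hf⟩ := h.exists_iso
  obtain ⟨r, hr, A', f', hA', hf'⟩ := (h'.mono hq).exists_iso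
  exact (IsLevelIso.le (hA.mono hr) hA' (hf.mono hr) hf').antisymm
    (IsLevelIso.le hA' (hA.mono hr) hf' (hf.mono hr))

/-- If every node has a level, the set of nodes below a given one is well ordered. -/
theorem exists_least_of_levels {T R t X : PName P} {γ : Ordinal.{u}}
    (hrefl : ∀ s, ∀ q ≤ p, ForcesMem s T q → ForcesPair R s s q)
    (ht : ForcesLevel T R t (ord P γ) p)
    (hX : ∀ s, ∀ q ≤ p, ForcesMem s X q → ForcesMem s T q ∧ ForcesPair R s t q)
    {s₀ : PName P} (hs₀ : ForcesMem s₀ X p) :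
    ∃ q ≤ p, ∃ m, ForcesMem m X q ∧ ∀ s, ∀ r ≤ q, ForcesMem s X r → ForcesPair R m s r := by
  obtain ⟨p₁, hp₁, A, f, hA, hf⟩ := ht.exists_iso
  -- `A` holds the strict predecessors of `t`. If some condition puts one of them into `X`, take the
  -- least label `β` over all such conditions and nodes at once; no stronger condition can then
  -- produce a smaller one. Otherwise `X` is forced to be `{t}`.
  by_cases H : ∃ β : Ordinal.{u}, β < γ ∧ ∃ q ≤ p₁, ∃ s, ForcesMem s X q ∧ ForcesMem s A q ∧
      ForcesPair f s (ord P β) q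
  · obtain ⟨β, ⟨hβ, q, hq, m, hm, hmA, hmβ⟩, hmin⟩ := exists_minimal_of_wellFoundedLT _ H
    refine ⟨q, hq.trans hp₁, m, hm, fun s r hr hs => .of_dense fun r₁ hr₁ => ?_⟩
    obtain ⟨hsT, hst⟩ := hX s r₁ (hr₁.trans (hr.trans (hq.trans hp₁))) (hs.mono hr₁)
    have hr₁q := hr₁.trans hr
    -- The node `t` itself carries no label, since it is not in `A`.
    by_cases h : ∃ r₂ ≤ r₁, ForcesEq s t r₂
    · obtain ⟨r₂, hr₂, e⟩ := h
      exact ⟨r₂, hr₂, ((hX m r₂ (hr₂.trans (hr₁q.trans (hq.trans hp₁)))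
        (hm.mono (hr₂.trans hr₁q))).2).congr (.refl _ _) (.refl _ _) e.symm⟩
    · push Not at h
      have hsA := hA.mem s r₁ (hr₁q.trans hq) hsT hst h
      obtain ⟨r₂, hr₂, δ, hδ, hsδ⟩ := hf.total s r₁ (hr₁q.trans hq) hsA
      have hr₂q := hr₂.trans hr₁q
      refine ⟨r₂, hr₂, (hf.iso m s r₂ (hr₂q.trans hq) (hmA.mono hr₂q) (hsA.mono hr₂) β hβ δ hδ
        (hmβ.mono hr₂q) hsδ).2 (le_of_not_gt fun hlt => ?_)⟩
      exact (hmin ⟨hδ, r₂, hr₂q.trans hq, s, hs.mono (hr₂.trans hr₁), hsA.mono hr₂, hsδ⟩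
        hlt.le).not_gt hlt
  · have key : ∀ s, ∀ r ≤ p₁, ForcesMem s X r → ForcesEq s t r := by
      refine fun s r hr hs => .of_dense fun r₁ hr₁ => ?_
      by_contra! h
      obtain ⟨hsT, hst⟩ := hX s r₁ (hr₁.trans (hr.trans hp₁)) (hs.mono hr₁)
      have hsA := hA.mem s r₁ (hr₁.trans hr) hsT hst h
      obtain ⟨r₂, hr₂, δ, hδ, hsδ⟩ := hf.total s r₁ (hr₁.trans hr) hsA
      exact H ⟨δ, hδ, r₂, hr₂.trans (hr₁.trans hr), s, hs.mono (hr₂.trans hr₁), hsA.mono hr₂, hsδ⟩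
    refine ⟨p₁, hp₁, s₀, hs₀.mono hp₁, fun s r hr hs => ?_⟩
    have h₀ := hs₀.mono (hr.trans hp₁)
    exact (hrefl s₀ r (hr.trans hp₁) (hX s₀ r (hr.trans hp₁) h₀).1).congr (.refl _ _) (.refl _ _)
      ((key s₀ r hr h₀).trans (key s r hr hs).symm)

end PName

end Ordinals

/-! ### The tree property in terms of names. -/

section Trees

open FirstOrder FirstOrder.Language

namespace PName

section Semantics

variable {P : Type u} [Preorder P] {n : ℕ} {v : Fin n → PName P} {p q : P} {κ : Ordinal.{u}}

/-- `p ⊩ |L| < k`. -/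
def ForcesCardLT (L k : PName P) (p : P) : Prop := Forces (Fml.cardLT (0 : Fin 2) 1) ![L, k] p

@[simp]
theorem forces_cardLT {L k : Fin n} :
    Forces (Fml.cardLT L k) v p ↔ ForcesCardLT (v L) (v k) p := by
  unfold ForcesCardLT
  simp only [Fml.cardLT, Fml.isFunc, Fml.isInj, Fml.isPair,
    Fml.isUPair, forces_bex, forces_ball, forces_inf, forces_sup, forces_ex, forces_imp,
    forces_pairMem, forces_mem, forces_eq, snoc_castSucc_apply, snoc_last_apply]
  rfl

theorem ForcesCardLT.congr {L L' k k' : PName P} (hL : ForcesEq L L' p) (hk : ForcesEq k k' p)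
    (h : ForcesCardLT L k p) : ForcesCardLT L' k' p := by
  refine Forces.congr (fun i => ?_) h
  match i with
  | 0 => exact hL
  | 1 => exact hk

/-- `p` forces that `L` is the level `α` of `(T, R)`. -/
def ForcesLevelSet (L T R α : PName P) (p : P) : Prop :=
  (∀ t, ∀ q ≤ p, ForcesMem t L q → ForcesMem t T q ∧ ForcesLevel T R t α q) ∧
    ∀ t, ∀ q ≤ p, ForcesMem t T q → ∀ r ≤ q, ForcesLevel T R t α r → ForcesMem t L r

@[simp]
theorem forces_isLevelSet {L T R α : Fin n} :
    Forces (Fml.isLevelSet L T R α) v p ↔ ForcesLevelSet (v L) (v T) (v R) (v α) p := by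
  simp [Fml.isLevelSet, ForcesLevelSet]

/-- `p` forces that the levels of the elements of `X` are cofinal in `κ`. -/
def ForcesCofinal (X T R : PName P) (κ : Ordinal.{u}) (p : P) : Prop :=
  ∀ α < κ, ∀ q ≤ p, ∃ r ≤ q, ∃ t, ∃ β < κ, α ≤ β ∧ ForcesMem t X r ∧ ForcesLevel T R t (ord P β) r

theorem forces_levelsCofinal {X T R k : Fin n} (hk : v k = ord P κ) :
    Forces (Fml.levelsCofinal X T R k) v p ↔ ForcesCofinal (v X) (v T) (v R) κ p := by
  simp only [Fml.levelsCofinal, forces_ball, forces_bex, forces_inf, forces_isLevel, forces_sup,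
    forces_mem, forces_eq, snoc_castSucc_apply, snoc_last_apply, hk]
  constructor
  · intro h α hα q hq
    obtain ⟨r, hr, t, ht, h⟩ := h (ord P α) q hq (forcesMem_ord.2 hα) q le_rfl
    obtain ⟨r₁, hr₁, b, hb, hl, h⟩ := h r le_rfl
    obtain ⟨r₂, hr₂, β, hβ, e⟩ := exists_of_forcesMem_ord hb
    obtain ⟨r₃, hr₃, h⟩ := h r₂ hr₂
    refine ⟨r₃, hr₃.trans (hr₂.trans (hr₁.trans hr)), t, β, hβ, ?_,
      ht.mono (hr₃.trans (hr₂.trans hr₁)),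
      (hl.mono (hr₃.trans hr₂)).congr (.refl _ _) (.refl _ _) (.refl _ _) (e.mono hr₃)⟩
    rcases h with h | h
    · exact (forcesMem_ord.1 (h.congr (.refl _ _) (e.mono hr₃))).le
    · exact (forcesEq_ord.1 (h.trans (e.mono hr₃))).le
  · intro h a q hq ha q₁ hq₁
    obtain ⟨q₂, hq₂, α, hα, e⟩ := exists_of_forcesMem_ord (ha.mono hq₁)
    obtain ⟨r, hr, t, β, hβ, hαβ, ht, hl⟩ := h α hα q₂ (hq₂.trans (hq₁.trans hq))
    refine ⟨r, hr.trans hq₂, t, ht, fun r₁ hr₁ => ⟨r₁, le_rfl, ord P β, forcesMem_ord.2 hβ,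
      hl.mono hr₁, fun r₂ hr₂ => ⟨r₂, le_rfl, ?_⟩⟩⟩
    have e' := (e.mono (hr₂.trans (hr₁.trans hr))).symm
    rcases hαβ.lt_or_eq with h | rfl
    · exact .inl ((forcesMem_ord.2 h).congr e' (.refl _ _))
    · exact .inr e'.symm

/-- `p` forces that `b` is a cofinal branch of `(T, R)`. -/
structure ForcesBranch (b T R : PName P) (κ : Ordinal.{u}) (p : P) : Prop where
  sub : ∀ s, ∀ q ≤ p, ForcesMem s b q → ForcesMem s T q
  chain : ∀ s, ∀ q ≤ p, ForcesMem s b q → ∀ t, ForcesMem t b q →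
    ∃ r ≤ q, ForcesPair R s t r ∨ ForcesPair R t s r
  cofinal : ForcesCofinal b T R κ p

theorem forces_isCofinalBranch {b T R k : Fin n} (hk : v k = ord P κ) :
    Forces (Fml.isCofinalBranch b T R k) v p ↔ ForcesBranch (v b) (v T) (v R) κ p := by
  simp only [Fml.isCofinalBranch, forces_inf, forces_levelsCofinal hk, forces_ball, forces_sup,
    forces_pairMem, forces_mem, snoc_castSucc_apply, snoc_last_apply]
  constructor
  · exact fun ⟨⟨h₁, h₂⟩, h₃⟩ =>
      ⟨h₁, fun s q hq hs t ht => h₂ s q hq hs t q le_rfl ht q le_rfl, h₃⟩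
  · exact fun ⟨h₁, h₂, h₃⟩ => ⟨⟨h₁, fun s q hq hs t q₁ hq₁ ht q₂ hq₂ =>
      h₂ s q₂ (hq₂.trans (hq₁.trans hq)) (hs.mono (hq₂.trans hq₁)) t (ht.mono hq₂)⟩, h₃⟩

/-- `p` forces that `(T, R)` is a `κ`-tree. -/
def ForcesKappaTree (T R : PName P) (κ : Ordinal.{u}) (p : P) : Prop :=
  Forces (Fml.isKappaTree (0 : Fin 3) 1 2) ![T, R, ord P κ] p

theorem forces_isKappaTree {T R k : Fin n} (hk : v k = ord P κ) :
    Forces (Fml.isKappaTree T R k) v p ↔ ForcesKappaTree (v T) (v R) κ p := by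
  unfold ForcesKappaTree
  simp only [Fml.isKappaTree, Fml.isTree, Fml.isPartialOrder, Fml.predsWellOrdered,
    Fml.levelsCofinal, forces_bex, forces_ball, forces_all, forces_inf, forces_sup, forces_ex,
    forces_imp, forces_pairMem, forces_isLevel, forces_isLevelSet, forces_cardLT,
    forces_mem, forces_eq, snoc_castSucc_apply, snoc_last_apply, hk]
  rfl

theorem forces_treeProperty {k : Fin n} (hk : v k = ord P κ) :
    Forces (Fml.treeProperty k) v p ↔ ∀ T R : PName P, ∀ q ≤ p, ForcesKappaTree T R κ q →
      ∃ r ≤ q, ∃ b, ForcesBranch b T R κ r := by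
  have hk' : ∀ T R : PName P, (Fin.snoc (Fin.snoc v T : Fin (n + 1) → PName P) R :
      Fin (n + 2) → PName P) k.castSucc.castSucc = ord P κ := by simp [hk]
  have hk'' : ∀ T R b : PName P, (Fin.snoc (Fin.snoc (Fin.snoc v T : Fin (n + 1) → PName P) R :
      Fin (n + 2) → PName P) b : Fin (n + 3) → PName P) k.castSucc.castSucc.castSucc
        = ord P κ := by simp [hk]
  simp only [Fml.treeProperty, forces_all, forces_imp, forces_isKappaTree (hk' _ _), forces_ex,
    forces_isCofinalBranch (hk'' _ _ _), snoc_castSucc_apply, snoc_last_apply]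
  exact forall₂_congr fun T R => ⟨fun h q hq hT => h q hq hT q le_rfl,
    fun h q hq hT q' hq' => h q' (hq'.trans hq) (Forces.mono hT hq')⟩

end Semantics

/-! ### Moving trees up and branches down along a projection. -/

variable {P Q : Type u} [Preorder P] [Preorder Q] {π : Q → P} (hπ : IsProjection π)
  {κ : Ordinal.{u}} {T R : PName P} {d : Q}

include hπ

theorem forcesPair_pull {r x y : PName P} :
    ForcesPair (pull π r) (pull π x) (pull π y) d ↔ ForcesPair r x y (π d) := by
  refine Iff.trans (Iff.of_eq ?_) (absolute_pairMem hπ (0 : Fin 3) 1 2 ![r, x, y] d)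
  unfold ForcesPair
  congr 1
  ext i
  fin_cases i <;> rfl

theorem ForcesLevel.pull {t : PName P} {α : Ordinal.{u}} (h : ForcesLevel T R t (ord P α) (π d)) :
    ForcesLevel (pull π T) (pull π R) (pull π t) (ord Q α) d := by
  refine (upward_isLevel hπ (0 : Fin 4) 1 2 3 ![T, R, t, ord P α] d h).congr fun i => ?_
  match i with
  | 0 | 1 | 2 => exact .refl _ _
  | 3 => exact pull_check _ _

theorem ForcesCardLT.pull {L : PName P} (h : ForcesCardLT L (ord P κ) (π d)) :
    ForcesCardLT (pull π L) (ord Q κ) d := by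
  refine (upward_cardLT hπ (0 : Fin 2) 1 ![L, ord P κ] d h).congr fun i => ?_
  match i with
  | 0 => exact .refl _ _
  | 1 => exact pull_check _ _

/-- Levels occur negatively here, so upward absoluteness is not enough. A node of level `α` in the
larger extension has some level in the smaller one by `hlev`; that level persists, and uniqueness
identifies it with `α`. -/
theorem ForcesLevelSet.pull {L : PName P} {α : Ordinal.{u}}
    (hlev : ∀ t, ∀ q ≤ π d, ForcesMem t T q → ∃ r ≤ q, ∃ β : Ordinal.{u},
      ForcesLevel T R t (ord P β) r)
    (h : ForcesLevelSet L T R (ord P α) (π d)) :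
    ForcesLevelSet (pull π L) (pull π T) (pull π R) (ord Q α) d := by
  constructor
  · intro t d₁ hd₁ ht
    have key : ∀ d₂ ≤ d₁, ∃ d₃ ≤ d₂, ForcesMem t (PName.pull π T) d₃ ∧
        ForcesLevel (PName.pull π T) (PName.pull π R) t (ord Q α) d₃ := by
      intro d₂ hd₂
      obtain ⟨d₃, hd₃, y, hy, e⟩ := exists_of_forcesMem_pull hπ.mono (ht.mono hd₂)
      obtain ⟨hyT, hyl⟩ := h.1 y _ (hπ.mono (hd₃.trans (hd₂.trans hd₁))) hy
      exact ⟨d₃, hd₃, ((forcesMem_pull hπ).2 hyT).congr e.symm (.refl _ _),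
        (ForcesLevel.pull hπ hyl).congr (.refl _ _) (.refl _ _) e.symm (.refl _ _)⟩
    exact ⟨.of_dense fun d₂ hd₂ => (key d₂ hd₂).imp fun _ h => ⟨h.1, h.2.1⟩,
      Forces.of_dense fun d₂ hd₂ => (key d₂ hd₂).imp fun _ h => ⟨h.1, h.2.2⟩⟩
  · intro t d₁ hd₁ ht d₂ hd₂ hl
    refine .of_dense fun d₃ hd₃ => ?_
    obtain ⟨d₄, hd₄, y, hy, e⟩ := exists_of_forcesMem_pull hπ.mono (ht.mono (hd₃.trans hd₂))
    have hd₄d := hd₄.trans (hd₃.trans (hd₂.trans hd₁))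
    obtain ⟨r, hr, β, hβ⟩ := hlev y _ (hπ.mono hd₄d) hy
    obtain ⟨d₅, hd₅, hr₅⟩ := hπ.lift d₄ r hr
    have hβ' := hβ.mono hr₅
    obtain rfl : β = α := (ForcesLevel.pull hπ hβ').unique
      ((hl.mono (hd₅.trans (hd₄.trans hd₃))).congr (.refl _ _) (.refl _ _) (e.mono hd₅) (.refl _ _))
    exact ⟨d₅, hd₅.trans hd₄, ((forcesMem_pull hπ).2 (h.2 y (π d₅) (hπ.mono (hd₅.trans hd₄d))
      (hy.mono (hπ.mono hd₅)) (π d₅) le_rfl hβ')).congr (e.mono hd₅).symm (.refl _ _)⟩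

/-- Being a `κ`-tree goes up along a projection. -/
theorem ForcesKappaTree.pull (h : ForcesKappaTree T R κ (π d)) :
    ForcesKappaTree (pull π T) (pull π R) κ d := by
  unfold ForcesKappaTree at h ⊢
  set v : Fin 3 → PName P := ![T, R, ord P κ]
  set w : Fin 3 → PName Q := ![PName.pull π T, PName.pull π R, ord Q κ]
  have hvw : ∀ i, ForcesEq ((PName.pull π ∘ v) i) (w i) d := fun i =>
    match i with
    | 0 | 1 => .refl _ _
    | 2 => pull_check _ _
  unfold Fml.isKappaTree Fml.isTree at h ⊢
  simp only [forces_inf] at h ⊢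
  obtain ⟨⟨⟨⟨⟨hpo, hmin⟩, -⟩, hlev⟩, hcof⟩, hsets⟩ := h
  have hpo' := (absolute_isPartialOrder hπ 0 1).upward _ _ hpo |>.congr hvw
  have hmin' := (Absolute.bex hπ (.ball hπ ((absolute_pairMem hπ _ _ _).imp hπ
    (absolute_eq hπ _ _)))).upward _ _ hmin |>.congr hvw
  have hlev' := Upward.ball hπ (.bex hπ (upward_isLevel hπ _ _ _ _)) _ _ hlev |>.congr hvw
  have hcof' := upward_levelsCofinal hπ 0 0 1 2 _ _ hcof |>.congr hvw
  refine ⟨⟨⟨⟨⟨hpo', hmin'⟩, ?_⟩, hlev'⟩, hcof'⟩, ?_⟩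
  -- The larger extension may have new subsets `X`, so well-orderedness does not simply persist. It
  -- is derived afresh from the fact that every node has an ordinal level.
  · simp only [Fml.isPartialOrder, forces_inf, forces_ball, forces_bex, forces_pairMem,
      forces_isLevel, snoc_castSucc_apply, snoc_last_apply] at hpo' hlev'
    simp only [Fml.predsWellOrdered, forces_all, forces_inf, forces_ball, forces_bex, forces_imp,
      forces_pairMem, forces_mem, forces_eq, snoc_castSucc_apply, snoc_last_apply]
    intro t d₁ hd₁ ht X d₂ hd₂ hX d₃ hd₃ hne d₄ hd₄
    obtain ⟨d₅, hd₅, s, hs, -⟩ := hne d₄ hd₄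
    have hd₅₂ := hd₅.trans (hd₄.trans hd₃)
    obtain ⟨d₆, hd₆, a, ha, hl⟩ := hlev' t d₁ hd₁ ht d₅ (hd₅₂.trans hd₂)
    obtain ⟨d₇, hd₇, α, -, e⟩ := exists_of_forcesMem_ord (β := κ) ha
    have hd₇₅ := hd₇.trans hd₆
    obtain ⟨d₈, hd₈, m, hm⟩ := exists_least_of_levels (X := X)
      (fun s q hq hs => hpo'.1.1 s q (hq.trans (hd₇₅.trans (hd₅₂.trans (hd₂.trans hd₁)))) hs)
      ((hl.mono hd₇).congr (.refl _ _) (.refl _ _) (.refl _ _) e)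
      (fun s q hq hs => hX s q (hq.trans (hd₇₅.trans hd₅₂)) hs) (hs.mono hd₇₅)
    exact ⟨d₈, hd₈.trans (hd₇₅.trans hd₅), m, hm⟩
  · simp only [forces_inf, forces_ball, forces_bex, forces_ex, forces_isLevel, forces_isLevelSet,
      forces_cardLT, snoc_castSucc_apply, snoc_last_apply] at hlev hsets ⊢
    intro a d₁ hd₁ ha d₂ hd₂
    obtain ⟨d₃, hd₃, α, hα, e⟩ := exists_of_forcesMem_ord (β := κ) (ha.mono hd₂)
    have hd₃d := hd₃.trans (hd₂.trans hd₁)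
    obtain ⟨r, hr, L, hL, hc⟩ := hsets (ord P α) (π d₃) (hπ.mono hd₃d) (forcesMem_ord.2 hα)
      (π d₃) le_rfl
    obtain ⟨d₄, hd₄, hr₄⟩ := hπ.lift d₃ r hr
    have hL' : ForcesLevelSet (PName.pull π L) (PName.pull π T) (PName.pull π R) (ord Q α) d₄ := by
      refine ForcesLevelSet.pull hπ (fun t q hq ht => ?_) ⟨fun t q hq => hL.1 t q (hq.trans hr₄),
        fun t q hq => hL.2 t q (hq.trans hr₄)⟩
      obtain ⟨r₁, hr₁, b, hb, hl⟩ := hlev t q (hq.trans (hπ.mono (hd₄.trans hd₃d))) ht q le_rfl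
      obtain ⟨r₂, hr₂, β, -, e'⟩ := exists_of_forcesMem_ord (β := κ) hb
      exact ⟨r₂, hr₂.trans hr₁, β, (hl.mono hr₂).congr (.refl _ _) (.refl _ _) (.refl _ _) e'⟩
    have e₄ := (e.mono hd₄).symm
    exact ⟨d₄, hd₄.trans hd₃, PName.pull π L,
      ⟨fun t q hq ht => (hL'.1 t q hq ht).imp_right
        (.congr (.refl _ _) (.refl _ _) (.refl _ _) (e₄.mono hq)),
      fun t q hq ht r₁ hr₁ hl => hL'.2 t q hq ht r₁ hr₁
        (hl.congr (.refl _ _) (.refl _ _) (.refl _ _) (e₄.mono (hr₁.trans hq)).symm)⟩,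
      ForcesCardLT.pull hπ (Forces.mono hc hr₄)⟩

omit hπ in
/-- The levels of the nodes of a `κ`-tree. -/
theorem ForcesKappaTree.exists_level {p : P} (h : ForcesKappaTree T R κ p) {t : PName P}
    (ht : ForcesMem t T p) : ∃ q ≤ p, ∃ α : Ordinal.{u}, ForcesLevel T R t (ord P α) q := by
  unfold ForcesKappaTree Fml.isKappaTree at h
  simp only [forces_inf, forces_ball, forces_bex, forces_isLevel, snoc_castSucc_apply,
    snoc_last_apply] at h
  obtain ⟨q, hq, a, ha, hl⟩ := h.1.1.2 t p le_rfl ht p le_rfl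
  obtain ⟨r, hr, α, -, e⟩ := exists_of_forcesMem_ord (β := κ) ha
  exact ⟨r, hr.trans hq, α, (hl.mono hr).congr (.refl _ _) (.refl _ _) (.refl _ _) e⟩

/-- The name for the set of those members of the `P`-name `T` which `d` forces to be in the
`Q`-name `b`. -/
def decided (π : Q → P) (b : PName Q) (d : Q) : PName P → PName P
  | ⟨ι, x, s⟩ =>
    ⟨{i : ι // π d ≤ s i ∧ ForcesMem (PName.pull π (x i)) b d}, fun i => x i, fun _ => π d⟩

omit hπ in
theorem exists_of_forcesMem_decided {b : PName Q} {a : PName P} {p : P}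
    (h : ForcesMem a (decided π b d T) p) : ∃ q ≤ p, ∃ y, q ≤ π d ∧ ForcesMem y T (π d) ∧
      ForcesMem (PName.pull π y) b d ∧ ForcesEq a y q := by
  obtain ⟨ι, x, s⟩ := T
  obtain ⟨q, hq, ⟨i, hi, hb⟩, hqd, e⟩ := h p le_rfl
  exact ⟨q, hq, x i, hqd, forcesMem_mk hi, hb, e⟩

omit hπ in
-- Every node of the branch is decided by some condition, but the condition depends on the node;
-- making one condition serve cofinally many nodes is left to a counting argument.
theorem exists_decided (hm : Monotone π) {b : PName Q} {a : PName Q}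
    (hT : ForcesMem a (PName.pull π T) d) (hb : ForcesMem a b d) :
    ∃ d' ≤ d, ∃ y, ForcesMem y T (π d') ∧ ForcesEq a (PName.pull π y) d' ∧
      ForcesMem y (decided π b d' T) (π d') := by
  obtain ⟨ι, x, s⟩ := T
  obtain ⟨d₁, hd₁, ⟨⟨j, e⟩, hj⟩, hje, w⟩ := hT d le_rfl
  have hs := (hm hje).trans hj
  have hb' := (hb.mono hd₁).congr w (.refl _ _)
  exact ⟨d₁, hd₁, x j, forcesMem_mk hs, w,
    forcesMem_mk (ι := {i : ι // π d₁ ≤ s i ∧ ForcesMem (PName.pull π (x i)) b d₁})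
      (x := fun i => x i) (r := fun _ => π d₁) (i := ⟨j, hs, hb'⟩) le_rfl⟩

/-- If `#Q` is less than the cofinality of `κ`, a cofinal branch in the extension by `Q` of a
`κ`-tree in the extension by `P` yields a cofinal branch in the extension by `P`. -/
theorem ForcesBranch.exists_decided (hκ : Cardinal.mk Q < κ.cof)
    (hT : ForcesKappaTree T R κ (π d)) {b : PName Q}
    (hb : ForcesBranch b (pull π T) (pull π R) κ d) :
    ∃ d' ≤ d, ForcesBranch (decided π b d' T) T R κ (π d') := by
  -- The decided nodes form a chain in `T` for any `d' ≤ d`: two of them are compared in the larger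
  -- extension, and comparability is absolute. Only cofinality depends on the choice of `d'`.
  suffices h : ∃ d' ≤ d, ForcesCofinal (decided π b d' T) T R κ (π d') by
    obtain ⟨d', hd', h⟩ := h
    refine ⟨d', hd', fun s q hq hs => .of_dense fun q₁ hq₁ => ?_, fun s q hq hs t ht => ?_, h⟩
    · obtain ⟨q₂, hq₂, y, hqd, hy, -, e⟩ := exists_of_forcesMem_decided (hs.mono hq₁)
      exact ⟨q₂, hq₂, (hy.mono hqd).congr e.symm (.refl _ _)⟩
    · obtain ⟨q₁, hq₁, y, hqd, -, hyb, e⟩ := exists_of_forcesMem_decided hs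
      obtain ⟨q₂, hq₂, z, -, -, hzb, e'⟩ := exists_of_forcesMem_decided (ht.mono hq₁)
      obtain ⟨d₁, hd₁, hq₃⟩ := hπ.lift d' q₂ (hq₂.trans hqd)
      obtain ⟨d₂, hd₂, H⟩ := hb.chain _ d₁ (hd₁.trans hd') (hyb.mono hd₁) _ (hzb.mono hd₁)
      have hq₂' := (hπ.mono hd₂).trans hq₃
      refine ⟨π d₂, hq₂'.trans (hq₂.trans hq₁), H.imp (fun H => ?_) (fun H => ?_)⟩
      · exact ((forcesPair_pull hπ).1 H).congr (.refl _ _) (e.mono (hq₂'.trans hq₂)).symm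
          (e'.mono hq₂').symm
      · exact ((forcesPair_pull hπ).1 H).congr (.refl _ _) (e'.mono hq₂').symm
          (e.mono (hq₂'.trans hq₂)).symm
  by_contra! H
  have H' : ∀ e : Q, ∃ α < κ, e ≤ d → ∃ q ≤ π e, ∀ r ≤ q, ∀ t, ∀ β < κ, α ≤ β →
      ForcesMem t (decided π b e T) r → ¬ ForcesLevel T R t (ord P β) r := by
    intro e
    by_cases he : e ≤ d
    · have := H e he
      unfold ForcesCofinal at this
      push Not at this
      obtain ⟨α, hα, h⟩ := this
      exact ⟨α, hα, fun _ => h⟩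
    -- Conditions not below `d` get the dummy bound `0`, which is below `κ` because `κ` has positive
    -- cofinality.
    · exact ⟨0, pos_iff_ne_zero.2 fun h => by simp [h] at hκ, fun h => absurd h he⟩
  choose α hα hd using H'
  have hsup : ⨆ e, α e < κ := Ordinal.iSup_lt_of_lt_cof hκ hα
  -- A branch node above all the bounds: the condition `d₂` that decides it violates its own bound
  -- `α d₂`.
  obtain ⟨d₁, hd₁, t, β, hβ, hle, htb, hl⟩ := hb.cofinal _ hsup d le_rfl
  obtain ⟨d₂, hd₂, y, hyT, e, hy⟩ := PName.exists_decided hπ.mono (hb.sub t d₁ hd₁ htb) htb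
  obtain ⟨q, hq, hn⟩ := hd d₂ (hd₂.trans hd₁)
  obtain ⟨r, hr, γ, hγ⟩ := ForcesKappaTree.exists_level
    (Forces.mono hT (hq.trans (hπ.mono (hd₂.trans hd₁)))) (hyT.mono hq)
  obtain ⟨d₃, hd₃, hr₃⟩ := hπ.lift d₂ r (hr.trans hq)
  -- The level `β` was computed in the larger extension and `γ` in the smaller; they agree because
  -- `γ` persists.
  obtain rfl : γ = β := (ForcesLevel.pull hπ (hγ.mono hr₃)).unique
    ((hl.mono (hd₃.trans hd₂)).congr (.refl _ _) (.refl _ _) (e.mono hd₃) (.refl _ _))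
  exact hn r hr y γ hβ ((Ordinal.le_iSup α d₂).trans hle) (hy.mono (hr.trans hq)) hγ

end PName

/-- The tree property goes down along a projection defined on a small forcing notion. -/
theorem ForcesTreePropertyAt.of_projection {P Q : Type u} [Preorder P] [Preorder Q] [Nonempty Q]
    {κ : Cardinal.{u}} (hκ : κ.IsRegular) (hQ : Cardinal.mk Q < κ)
    (hproj : ∀ p : P, ∃ π : Q → P, IsProjection π ∧ ∀ d, π d ≤ p)
    (h : ForcesTreePropertyAt Q κ) : ForcesTreePropertyAt P κ := by
  intro p
  rw [PName.forces_treeProperty (κ := κ.ord) rfl]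
  intro T R q _ hT
  -- The range of `π` lies below `q`, so every `π d` forces that `T` is a tree, whatever `d` is.
  obtain ⟨π, hπ, hle⟩ := hproj q
  obtain ⟨d⟩ := ‹Nonempty Q›
  have hd := h d
  rw [PName.forces_treeProperty (κ := κ.ord) rfl] at hd
  have hT' : PName.ForcesKappaTree T R κ.ord (π d) := PName.Forces.mono hT (hle d)
  obtain ⟨d₁, hd₁, b, hb⟩ := hd _ _ d le_rfl (PName.ForcesKappaTree.pull hπ hT')
  obtain ⟨d₂, _, hb'⟩ := PName.ForcesBranch.exists_decided hπ (by rwa [hκ.cof_ord])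
    (PName.Forces.mono hT (hle d₁)) hb
  exact ⟨π d₂, hle d₂, _, hb'⟩

end Trees

/-! ### The one-point forcing and truth in the ground model. -/

section TrivialForcing

open FirstOrder FirstOrder.Language

namespace PName

/-- The set named by a name for the trivial forcing. -/
def toPSet {P : Type u} : PName P → PSet.{u}
  | ⟨ι, x, _⟩ => ⟨ι, fun i => toPSet (x i)⟩

theorem toPSet_surjective : Function.Surjective (toPSet (P := PUnit.{u + 1})) := by
  intro x
  induction x with
  | mk ι A ih =>
    choose a ha using ih
    exact ⟨⟨ι, a, fun _ => ⟨⟩⟩, congrArg (PSet.mk ι) (funext ha)⟩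

theorem toPSet_check (x : PSet.{u}) : PSet.Equiv (toPSet (check PUnit.{u + 1} x)) x := by
  induction x with
  | mk ι A ih => exact ⟨fun i => ⟨i.1, ih i.1⟩, fun i => ⟨(i, ⟨⟩), ih i⟩⟩

/-- With a single condition the density clauses are vacuous, and what remains is extensional
equality of sets. -/
theorem forcesEq_punit {a b : PName PUnit.{u + 1}} {p : PUnit.{u + 1}} :
    ForcesEq a b p ↔ PSet.Equiv (toPSet a) (toPSet b) := by
  induction a generalizing b p with
  | mk ι x r ih =>
    obtain ⟨κ, y, s⟩ := b
    constructor
    · intro h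
      refine ⟨fun i => ?_, fun j => ?_⟩
      · obtain ⟨_, _, j, _, w⟩ := h.1 i p le_rfl le_rfl
        exact ⟨j, (ih i).1 w⟩
      · obtain ⟨_, _, i, _, w⟩ := h.2 j p le_rfl le_rfl
        exact ⟨i, (ih i).1 w⟩
    · intro h
      refine ⟨fun i q _ _ => ?_, fun j q _ _ => ?_⟩
      · obtain ⟨j, hj⟩ := h.1 i
        exact ⟨q, le_rfl, j, le_rfl, (ih i).2 hj⟩
      · obtain ⟨i, hi⟩ := h.2 j
        exact ⟨q, le_rfl, i, le_rfl, (ih i).2 hi⟩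

theorem forcesMem_punit {a b : PName PUnit.{u + 1}} {p : PUnit.{u + 1}} :
    ForcesMem a b p ↔ toPSet a ∈ toPSet b := by
  obtain ⟨κ, y, s⟩ := b
  constructor
  · intro h
    obtain ⟨_, _, j, _, w⟩ := h p le_rfl
    exact ⟨j, forcesEq_punit.1 w⟩
  · rintro ⟨j, hj⟩ q _
    exact ⟨q, le_rfl, j, le_rfl, forcesEq_punit.2 hj⟩

theorem mk_toPSet_ofTerm {n : ℕ} (v : Fin n → PName PUnit.{u + 1})
    (t : setLang.Term (Empty ⊕ Fin n)) :
    ZFSet.mk (toPSet (ofTerm v t)) =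
      t.realize (Sum.elim Empty.elim fun i => ZFSet.mk (toPSet (v i))) := by
  match t with
  | .var (.inr i) => rfl
  | .var (.inl e) => exact nomatch e
  | .func f _ => exact nomatch f

/-- The trivial forcing forces exactly what is true in the ground model. -/
theorem forces_punit_iff {n : ℕ} {φ : Fml n} {v : Fin n → PName PUnit.{u + 1}}
    {p : PUnit.{u + 1}} :
    Forces φ v p ↔
      φ.Realize (M := ZFSet.{u}) Empty.elim fun i => ZFSet.mk (toPSet (v i)) := by
  induction φ generalizing p with
  | falsum => exact Iff.rfl
  | equal a b =>
    change ForcesEq _ _ _ ↔ _ = _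
    rw [forcesEq_punit, ← ZFSet.eq, mk_toPSet_ofTerm, mk_toPSet_ofTerm]
  | rel R ts =>
    cases R
    change ForcesMem _ _ _ ↔ _ ∈ _
    rw [forcesMem_punit, ← ZFSet.mk_mem_iff, mk_toPSet_ofTerm, mk_toPSet_ofTerm]
  | imp φ ψ ih₁ ih₂ =>
    rw [forces_imp, BoundedFormula.realize_imp]
    simp only [ih₁, ih₂]
    exact ⟨fun h => h p le_rfl, fun h _ _ => h⟩
  | all φ ih =>
    rw [BoundedFormula.realize_all]
    change (∀ x, Forces φ (Fin.snoc v x) p) ↔ _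
    have hs : ∀ x, (fun i => ZFSet.mk (toPSet ((Fin.snoc v x : Fin _ → PName _) i))) =
        Fin.snoc (fun i => ZFSet.mk (toPSet (v i))) (ZFSet.mk (toPSet x)) :=
      fun x => Fin.comp_snoc (fun a => ZFSet.mk (toPSet a)) v x
    simp only [ih, hs]
    constructor
    · intro h a
      obtain ⟨y, rfl⟩ := Quotient.exists_rep a
      obtain ⟨x, rfl⟩ := toPSet_surjective y
      exact h x
    · exact fun h x => h _

end PName

theorem TreePropertyAt.of_forces_punit {κ : Cardinal.{u}}
    (h : ForcesTreePropertyAt PUnit.{u + 1} κ) : TreePropertyAt κ := by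
  have := PName.forces_punit_iff.1 (h ⟨⟩)
  unfold TreePropertyAt
  convert! this using 1
  funext i
  obtain rfl : i = 0 := Subsingleton.elim _ _
  exact (ZFSet.eq.2 (PName.toPSet_check _)).symm

end TrivialForcing

/-! ### The collapse projects to every small forcing notion. -/

section Collapse

namespace Col

variable {X : Type u} {P : Type u} [Preorder P]

instance : Nonempty (Col X) := ⟨⟨fun _ => none, by simp⟩⟩

open Classical in
/-- The descending walk through `P` that starts at `p` and at step `n` moves to the condition
coded by the `n`-th value of `g`, if this is an extension. -/
noncomputable def walk (e : X → P) (p : P) (g : ℕ → Option X) : ℕ → P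
  | 0 => p
  | n + 1 => match g n with
    | none => walk e p g n
    | some x => if e x ≤ walk e p g n then e x else walk e p g n

variable {e : X → P} {p : P}

theorem walk_succ_le (g : ℕ → Option X) (n : ℕ) : walk e p g (n + 1) ≤ walk e p g n := by
  rw [walk]
  split
  · exact le_rfl
  · split_ifs with h
    · exact h
    · exact le_rfl

theorem walk_antitone (g : ℕ → Option X) : Antitone (walk e p g) :=
  antitone_nat_of_succ_le (walk_succ_le g)

theorem walk_congr {g g' : ℕ → Option X} {n : ℕ} (h : ∀ m < n, g m = g' m) :
    walk e p g n = walk e p g' n := by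
  induction n with
  | zero => rfl
  | succ n ih =>
    unfold walk
    rw [h n n.lt_succ_self, ih fun m hm => h m (hm.trans n.lt_succ_self)]

theorem exists_eq_none (c : Col X) : ∃ n, c.toFun n = none := by
  by_contra! h
  exact Set.infinite_univ (c.finite_dom.subset fun n _ => h n)

open Classical in
/-- The length of the longest initial segment of `ω` contained in the domain of `c`. -/
noncomputable def len (c : Col X) : ℕ := Nat.find c.exists_eq_none

theorem ne_none_of_lt_len {c : Col X} {n : ℕ} (h : n < c.len) : c.toFun n ≠ none :=
  Nat.find_min c.exists_eq_none h

theorem le_len {c : Col X} {n : ℕ} (h : ∀ m < n, c.toFun m ≠ none) : n ≤ c.len :=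
  (Nat.le_find_iff _ _).2 h

theorem apply_eq_of_le {c c' : Col X} (h : c' ≤ c) {n : ℕ} (hn : c.toFun n ≠ none) :
    c'.toFun n = c.toFun n := by
  obtain ⟨x, hx⟩ := Option.ne_none_iff_exists'.1 hn
  rw [hx, h n x hx]

/-- If `e : X → P` is surjective, walking through `P` is a projection of `Col(ω, X)`. -/
theorem isProjection_walk (he : Function.Surjective e) :
    IsProjection fun c : Col X => walk e p c.toFun c.len := by
  classical
  have agree : ∀ {c c' : Col X}, c' ≤ c → walk e p c'.toFun c.len = walk e p c.toFun c.len :=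
    fun h => walk_congr fun m hm => apply_eq_of_le h (ne_none_of_lt_len hm)
  constructor
  -- Only values before the first gap of `c` steer its walk. An extension agrees with `c` there and
  -- walks at least as far.
  · intro c' c h
    change walk e p c'.toFun c'.len ≤ walk e p c.toFun c.len
    rw [← agree h]
    refine walk_antitone _ (le_len fun m hm => ?_)
    rw [apply_eq_of_le h (ne_none_of_lt_len hm)]
    exact ne_none_of_lt_len hm
  · intro c q hq
    obtain ⟨x, rfl⟩ := he q
    -- The code of `q` is written into the first gap, so the next step of the walk moves to `q`.
    let c' : Col X := ⟨Function.update c.toFun c.len (some x),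
      (c.finite_dom.insert c.len).subset fun n hn => by
        by_cases h : n = c.len
        · exact .inl h
        · exact .inr (by simpa [h] using hn)⟩
    have hc' : c' ≤ c := fun n y hy => by
      have hn : n ≠ c.len := by
        rintro rfl
        rw [len, Nat.find_spec c.exists_eq_none] at hy
        cases hy
      exact (Function.update_of_ne hn _ _).trans hy
    have hlast : c'.toFun c.len = some x := Function.update_self ..
    -- Filling the gap may join further values of `c` to the initial segment, so `c'` can walk
    -- beyond `c.len + 1`. This only descends further, hence `≤ q` rather than equality.
    refine ⟨c', hc', (walk_antitone c'.toFun (le_len (n := c.len + 1) fun m hm => ?_)).trans ?_⟩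
    · rcases (Nat.lt_succ_iff.1 hm).lt_or_eq with h | rfl
      · rw [apply_eq_of_le hc' (ne_none_of_lt_len h)]
        exact ne_none_of_lt_len h
      · simp [hlast]
    · rw [walk, hlast, agree hc']
      simp only
      rw [if_pos hq]

theorem walk_le (g : ℕ → Option X) (n : ℕ) : walk e p g n ≤ p := walk_antitone g n.zero_le

/-- A condition is determined by a finite list enumerating its graph, and there are at most `max ℵ₀
|X|` such lists. -/
theorem mk_le (X : Type u) : Cardinal.mk (Col X) ≤ max Cardinal.aleph0 (Cardinal.mk X) := by
  classical
  have hf : Function.Injective fun c : Col X =>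
      (c.finite_dom.toFinset.toList.map fun n => (n, c.toFun n)) := by
    intro c c' h
    have key : ∀ (c : Col X) n x, c.toFun n = some x ↔
        (n, some x) ∈ c.finite_dom.toFinset.toList.map fun n => (n, c.toFun n) := by
      intro c n x
      simp only [List.mem_map, Finset.mem_toList, Set.Finite.mem_toFinset, Set.mem_ofPred_eq,
        Prod.mk.injEq]
      exact ⟨fun h => ⟨n, by simp [h], rfl, h⟩, by rintro ⟨_, _, rfl, h⟩; exact h⟩
    ext n x
    rw [key c, key c']
    exact iff_of_eq (congrArg _ h)
  refine (Cardinal.mk_le_of_injective hf).trans ((Cardinal.mk_list_le_max _).trans ?_)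
  refine max_le (le_max_left _ _) ?_
  simp only [Cardinal.mk_prod, Cardinal.mk_option, Cardinal.lift_uzero, Cardinal.mk_nat,
    Cardinal.lift_aleph0]
  refine (Cardinal.mul_le_max_of_aleph0_le_left le_rfl).trans (max_le (le_max_left _ _) ?_)
  refine (Cardinal.add_le_max _ _).trans (max_le (max_le (le_max_right _ _) ?_) (le_max_left _ _))
  exact Cardinal.one_lt_aleph0.le.trans (le_max_left _ _)

end Col

end Collapse

/-- If cofinally many collapses below `lam` force the tree property at the successor of `lam`, then
so does every forcing notion of size less than `lam`. -/
theorem ForcesTreePropertyAt.of_collapses {lam : Cardinal.{u}} (hlam : Cardinal.aleph0 ≤ lam)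
    (h : ∀ μ < lam, ∃ μ', μ ≤ μ' ∧ μ' < lam ∧
      ForcesTreePropertyAt (ColOmega μ') (Order.succ lam))
    (P : Type u) [Preorder P] [Nonempty P] (hP : Cardinal.mk P < lam) :
    ForcesTreePropertyAt P (Order.succ lam) := by
  obtain ⟨μ, hPμ, hμ, hC⟩ := h _ hP
  -- The collapse has at most `max ℵ₀ μ ≤ λ` conditions, fewer than the cofinality of `λ⁺`.
  have hcol : Cardinal.mk (ColOmega μ) < Order.succ lam := by
    refine Order.lt_succ_of_le ((Col.mk_le _).trans ?_)
    rw [Cardinal.mk_ord_toType]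
    exact max_le hlam hμ.le
  rw [← Cardinal.mk_ord_toType μ] at hPμ
  obtain ⟨f⟩ := hPμ
  exact .of_projection (Cardinal.isRegular_succ hlam) hcol
    (fun p => ⟨_, Col.isProjection_walk (p := p) (Function.invFun_surjective f.injective),
      fun _ => Col.walk_le _ _⟩) hC

theorem mainTheorem8 (lam : Cardinal.{u}) (hlam : Cardinal.aleph0 ≤ lam) :
    -- the lemma itself
    ((TreePropertyAt (Order.succ lam) ∧
        ∀ μ < lam, ForcesTreePropertyAt (ColOmega μ) (Order.succ lam)) →
      ∀ (P : Type u) [Preorder P] [Nonempty P], Cardinal.mk P < lam →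
        ForcesTreePropertyAt P (Order.succ lam)) ∧
    -- the "moreover" part
    ((∀ μ < lam, ∃ μ', μ ≤ μ' ∧ μ' < lam ∧
        ForcesTreePropertyAt (ColOmega μ') (Order.succ lam)) →
      TreePropertyAt (Order.succ lam) ∧
      ∀ (P : Type u) [Preorder P] [Nonempty P], Cardinal.mk P < lam →
        ForcesTreePropertyAt P (Order.succ lam)) := by
  -- The first part is the case `μ' = μ`. In the second, the tree property in the ground model comes
  -- from the one-point forcing, whose size `1` is below `λ`.
  refine ⟨fun h P _ _ hP => .of_collapses hlam (fun μ hμ => ⟨μ, le_rfl, hμ, h.2 μ hμ⟩) P hP,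
    fun h => ⟨.of_forces_punit (.of_collapses hlam h _ ?_),
      fun P _ _ hP => .of_collapses hlam h P hP⟩⟩
  rw [Cardinal.mk_punit]
  exact Cardinal.one_lt_aleph0.trans_le hlam
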